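/- Let $N$ be a free abelian group of finite rank $n$, let $N_{\mathbb Q}=\mathbb Q\otimes N$ and let $M=\mathbb Q\otimes\operatorname{Hom}(N,\mathbb Z)$ be its dual. Let $\Sigma$ be a (non-empty, finite) simplicial fan of strongly convex rational polyhedral cones in $N_{\mathbb Q}$, with toric variety $X$. Let $\rho_1,\dots,\rho_r$ be the rays of $\Sigma$ and let $v_i$ be the first lattice point of $N$ along $\rho_i$. Let $Z_*(X)_{\mathbb Q}$ be the $\mathbb Q$-vector space with basis the classes $[V(\sigma)]$, $\sigma\in\Sigma$, of the invariant subvarieties of $X$; in particular $[X]=[V(0)]$, and $D_i=[V(\rho_i)]$. For $\sigma\in\Sigma$ let $M(\sigma)=\sigma^\perp\subseteq M$ and $M_\sigma=M/M(\sigma)$, and let $N_\sigma$ be the subgroup of $N$ generated by $\sigma\cap N$. An equivariant $\mathbb Q$-Cartier divisor $D$ on $X$ is a family of local equations $m_\sigma\in M_\sigma$ $(\sigma\in\Sigma)$ such that $m_\sigma\mapsto m_\tau$ under $M_\sigma\to M_\tau$ whenever $\tau$ is a face of $\sigma$. Its cycle is $[D]=\sum_i\langle m_{\rho_i},v_i\rangle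 D_i$. Fix an inner product on $M$, i.e. a positive definite symmetric $\mathbb Q$-bilinear form $\langle\cdot,\cdot\rangle_M$ with values in $\mathbb Q$, and let $\Psi(\sigma)$ be the orthogonal complement of $M(\sigma)$. Let $\pi_\sigma$ denote the projection $M\to M(\sigma)$ with kernel $\Psi(\sigma)$, and also, for $\sigma$ a face of $\tau$, the induced map $M_\tau\to M(\sigma)/M(\tau)$. A $\mathbb Q$-Cartier divisor $D$ acts on $Z_*(X)_{\mathbb Q}$ by the linear map with $$D\cdot[V(\sigma)]=\sum_{\tau}\langle\pi_\sigma(m_\tau),n_{\tau,\sigma}\rangle[V(\tau)],$$ where $\tau$ runs over the cones of $\Sigma$ that have $\sigma$ as a facet, and $n_{\tau,\sigma}\in N/N_\sigma$ is the first lattice point along the image of $\tau$, that is, the generator of $N_\tau/N_\sigma$ lying in the image of $\tau$. Let $\omega:N_{\mathbb Q}\to M$ be the isomorphism with $\langle m,\omega(v)\rangle_M=\langle m,v\rangle$ for all $m\in M$ and $v\in N_{\mathbb Q}$. In $\mathbb Q[Y_1,\dots,Y_r]$ let $I_\Sigma$ be the ideal generated by the products $Y_{i_1}\cdots Y_{i_s}$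 such that $\rho_{i_1},\dots,\rho_{i_s}$ are not all contained in some cone of $\Sigma$, and let $J$ be the ideal generated by $\sum_{j=1}^r\langle\omega(v_j),v_i\rangle Y_iY_j$ for $1\le i\le r$. **Theorem 9.1.** Each $D_i$ is the cycle of a unique $\mathbb Q$-Cartier divisor. There is a unique $\mathbb Q$-bilinear product on $Z_*(X)_{\mathbb Q}$ that makes it a commutative associative ring with unit $[X]$ and satisfies $[D]\,z=D\cdot z$ for every $\mathbb Q$-Cartier divisor $D$ and every $z\in Z_*(X)_{\mathbb Q}$. For this ring structure, the homomorphism of $\mathbb Q$-algebras $\alpha:\mathbb Q[Y_1,\dots,Y_r]\to Z_*(X)_{\mathbb Q}$, $Y_i\mapsto D_i$, is surjective with kernel $I_\Sigma+J$. Hence $$Z_*(X)_{\mathbb Q}\cong\mathbb Q[Y_1,\dots,Y_r]/(I_\Sigma+J).$$ -/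

import Mathlib

open scoped TensorProduct

noncomputable section

namespace ToricCycle

/-! ### Lattices, cones and fans

Throughout, `N` is a free abelian group of finite rank. -/

/-- `N_ℚ = ℚ ⊗ N`. -/
abbrev NQ (N : Type*) [AddCommGroup N] : Type _ := ℚ ⊗[ℤ] N

/-- `M_ℚ = ℚ ⊗ Hom(N, ℤ)`, realized as the dual of `N_ℚ`, so that the duality pairing is
evaluation. -/
abbrev MQ (N : Type*) [AddCommGroup N] : Type _ := Module.Dual ℚ (NQ N)

/-- The embedding `N → N_ℚ`. -/
def ι {N : Type*} [AddCommGroup N] (n : N) : NQ N := (1 : ℚ) ⊗ₜ[ℤ] n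

/-- Cones in `N_ℚ`. Since the scalars are rational, the finitely generated ones are exactly the
rational polyhedral cones. -/
abbrev Cone (N : Type*) [AddCommGroup N] : Type _ := PointedCone ℚ (NQ N)

section

variable {N : Type*} [AddCommGroup N]

/-- The linear span of a cone. -/
def linSpan (σ : Cone N) : Submodule ℚ (NQ N) := Submodule.span ℚ (σ : Set (NQ N))

/-- The dimension of a cone. -/
def dim (σ : Cone N) : ℕ := Module.finrank ℚ (linSpan σ)

/-- `M(σ) = σ^⊥`, as a subspace of `M_ℚ`. -/
def perp (σ : Cone N) : Submodule ℚ (MQ N) where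
  carrier := {m | ∀ x ∈ σ, m x = 0}
  zero_mem' := fun _ _ => rfl
  add_mem' := fun {a b} ha hb x hx => by
    rw [LinearMap.add_apply, ha x hx, hb x hx, add_zero]
  smul_mem' := fun c a ha x hx => by
    rw [LinearMap.smul_apply, ha x hx, smul_zero]

theorem perp_anti {σ τ : Cone N} (h : σ ≤ τ) : perp τ ≤ perp σ :=
  fun _ hm x hx => hm x (h hx)

/-- `N_σ`, the subgroup of `N` generated by `σ ∩ N`. -/
def latticeSpan (σ : Cone N) : AddSubgroup N := AddSubgroup.closure {n | ι n ∈ σ}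

theorem perp_apply_eq_zero {σ : Cone N} {m : MQ N} (hm : m ∈ perp σ) {n : N}
    (hn : n ∈ latticeSpan σ) : m (ι n) = 0 := by
  unfold latticeSpan at hn
  induction hn using AddSubgroup.closure_induction with
  | mem x hx => exact hm _ hx
  | zero => simp [ι]
  | add x y _ _ hx hy => simp only [ι, TensorProduct.tmul_add, map_add] at *; rw [hx, hy, add_zero]
  | neg x _ hx => simp only [ι, TensorProduct.tmul_neg, map_neg] at *; rw [hx, neg_zero]

/-- `σ` is a facet (a maximal proper face) of `τ`. -/
def IsFacetOf (σ τ : Cone N) : Prop :=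
  Maximal (fun γ : Cone N => γ.IsFaceOf τ ∧ γ ≠ τ) σ

/-- `n ∈ N_τ` represents `n_{τ,σ}`: its class generates the lattice `N(σ)_τ = N_τ / N_σ`, and the
image of `n` in `N(σ)_ℚ = N_ℚ / span σ` lies in the image of the cone `τ`. When `σ` is a facet of
`τ`, this determines the class of `n` in `N(σ) = N / N_σ`, and that class is the first lattice
point of `N(σ)` along the ray which is the image of `τ`. -/
def IsNormalVector (τ σ : Cone N) (n : N) : Prop :=
  latticeSpan τ = latticeSpan σ ⊔ AddSubgroup.zmultiples n ∧ ∃ x ∈ τ, ι n - x ∈ linSpan σ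

open scoped Classical in
/-- A representative in `N_τ` of `n_{τ,σ}` (and `0` if there is none, which does not happen for a
facet `σ` of a strongly convex rational polyhedral cone `τ`). -/
def normalVector (τ σ : Cone N) : N :=
  if h : ∃ n, IsNormalVector τ σ n then h.choose else 0

theorem normalVector_mem (τ σ : Cone N) : normalVector τ σ ∈ latticeSpan τ := by
  unfold normalVector
  split
  · next h =>
    rw [h.choose_spec.1]
    exact AddSubgroup.mem_sup_right (AddSubgroup.mem_zmultiples _)
  · exact zero_mem _

/-- The first lattice point of `N` along the ray `ρ`: this is `n_{ρ,σ}` for `σ = 0`. -/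
def primitive (ρ : Cone N) : N := normalVector ρ ⊥

/-- The duality pairing of `M_τ = M / M(τ)` with an element of `N_τ`. -/
def pairing (τ : Cone N) (n : N) (hn : n ∈ latticeSpan τ) : (MQ N ⧸ perp τ) →ₗ[ℚ] ℚ :=
  (perp τ).liftQ (Module.Dual.eval ℚ (NQ N) (ι n)) fun _ hm => perp_apply_eq_zero hm hn

end

/-- A (finite) fan in `N_ℚ`. -/
structure Fan (N : Type*) [AddCommGroup N] where
  /-- the cones of the fan -/
  cones : Finset (Cone N)
  nonempty : cones.Nonempty
  polyhedral : ∀ σ ∈ cones, Submodule.FG σ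
  stronglyConvex : ∀ σ ∈ cones, ConvexCone.Salient (σ : ConvexCone ℚ (NQ N))
  face_mem : ∀ σ ∈ cones, ∀ τ : Cone N, τ.IsFaceOf σ → τ ∈ cones
  inter_isFaceOf : ∀ σ ∈ cones, ∀ τ ∈ cones, (σ ⊓ τ).IsFaceOf σ ∧ (σ ⊓ τ).IsFaceOf τ

namespace Fan

variable {N : Type*} [AddCommGroup N] (F : Fan N)

/-- The fan is simplicial: each cone is generated by linearly independent vectors. -/
def IsSimplicial : Prop := ∀ σ ∈ F.cones, PointedCone.IsSimplicial σ

theorem bot_mem : (⊥ : Cone N) ∈ F.cones := by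
  obtain ⟨σ, hσ⟩ := F.nonempty
  refine F.face_mem σ hσ ⊥ (PointedCone.IsFaceOf.of_mem_of_add_mem_left bot_le ?_)
  intro x y hx hy hxy
  by_contra hne
  have hxy' : x + y = 0 := hxy
  refine F.stronglyConvex σ hσ x hx hne ?_
  rw [neg_eq_of_add_eq_zero_right hxy']
  exact hy

/-- The rays `ρ_1, …, ρ_r` of the fan. -/
abbrev Ray : Type _ := {ρ : F.cones // dim (ρ : Cone N) = 1}

instance : Fintype F.Ray := by
  classical
  exact Subtype.fintype _

/-! ### Invariant cycles and `ℚ`-Cartier divisors -/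

/-- `Z_*(X)_ℚ`: the rational vector space with basis the classes `[V(σ)]`, `σ` in the fan. -/
abbrev Cycles : Type _ := F.cones →₀ ℚ

variable {F} in
/-- The cycle `[V(σ)]`. -/
def V (σ : F.cones) : F.Cycles := Finsupp.single σ 1

/-- The cycle `[X] = [V(0)]`. -/
def fundamentalCycle : F.Cycles := V ⟨⊥, F.bot_mem⟩

/-- Equivariant `ℚ`-Cartier divisors: families of local equations `m_σ ∈ M_σ = M / M(σ)` such that
`m_σ` maps to `m_τ` under `M_σ → M_τ` whenever `τ` is a face of `σ`. -/
def QCartier : Submodule ℚ (∀ σ : F.cones, MQ N ⧸ perp (σ : Cone N)) where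
  carrier := {m | ∀ (σ τ : F.cones) (h : (τ : Cone N).IsFaceOf σ),
    Submodule.factor (perp_anti h.le) (m σ) = m τ}
  zero_mem' := fun _ _ _ => by simp
  add_mem' := fun {a b} ha hb σ τ h => by
    rw [Pi.add_apply, map_add, ha σ τ h, hb σ τ h, Pi.add_apply]
  smul_mem' := fun c a ha σ τ h => by
    rw [Pi.smul_apply, map_smul, ha σ τ h, Pi.smul_apply]

variable {F} in
/-- The cycle `[D] = ∑ ⟨m_ρ, v_ρ⟩ [V(ρ)]` of a `ℚ`-Cartier divisor, the sum being over the rays. -/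
def divisorCycle (D : F.QCartier) : F.Cycles :=
  ∑ ρ : F.Ray, pairing (ρ : Cone N) (primitive (ρ : Cone N)) (normalVector_mem _ _)
    (D.1 ρ.1) • V ρ.1

/-! ### The action of divisors on cycles -/

/-- A choice of complements for the fan. -/
structure Complements where
  /-- the subspace `Ψ(σ)` of `M_ℚ` -/
  Ψ : F.cones → Submodule ℚ (MQ N)
  isCompl : ∀ σ : F.cones, IsCompl (perp (σ : Cone N)) (Ψ σ)
  mono : ∀ σ τ : F.cones, (τ : Cone N).IsFaceOf σ → Ψ τ ≤ Ψ σ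

variable {F}

/-- The projection `π_σ` of `M` onto `M(σ)` along `Ψ(σ)`, as an endomorphism of `M`. -/
def Complements.proj (P : F.Complements) (σ : F.cones) : MQ N →ₗ[ℚ] MQ N :=
  (perp (σ : Cone N)).projection (P.Ψ σ) (P.isCompl σ)

theorem Complements.perp_le_comap_proj (P : F.Complements) (σ τ : F.cones)
    (h : (σ : Cone N) ≤ τ) :
    perp (τ : Cone N) ≤ (perp (τ : Cone N)).comap (P.proj σ) := by
  intro m hm
  have hm' : m ∈ perp (σ : Cone N) := perp_anti h hm
  have : P.proj σ m = m := by
    rw [Complements.proj, Submodule.projection_apply]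
    exact congrArg Subtype.val
      (Submodule.projectionOnto_apply_left (P.isCompl σ) (⟨m, hm'⟩ : perp (σ : Cone N)))
  rw [Submodule.mem_comap, this]
  exact hm

/-- For `σ` contained in `τ`, the map `π_σ : M_τ → M(σ)_τ` induced by `π_σ : M → M(σ)`, where
`M(σ)_τ = M(σ) / M(τ)` is regarded as a subspace of `M_τ = M / M(τ)`. -/
def Complements.projQuot (P : F.Complements) (σ τ : F.cones) (h : (σ : Cone N) ≤ τ) :
    (MQ N ⧸ perp (τ : Cone N)) →ₗ[ℚ] (MQ N ⧸ perp (τ : Cone N)) :=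
  Submodule.mapQ _ _ (P.proj σ) (P.perp_le_comap_proj σ τ h)

open scoped Classical in
/-- `D · [V(σ)]`, the sum over all cones `τ` having `σ` as a facet of
`⟨π_σ(m_τ), n_{τ,σ}⟩ [V(τ)]`, where `m_τ` is the local equation of `D` on `τ`. -/
def Complements.actOn (P : F.Complements) (D : F.QCartier) (σ : F.cones) : F.Cycles :=
  ∑ τ : F.cones, if h : IsFacetOf (σ : Cone N) (τ : Cone N) then
    pairing (τ : Cone N) (normalVector τ σ) (normalVector_mem _ _)
      (P.projQuot σ τ h.prop.1.le (D.1 τ)) • V τ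
  else 0

/-- The action `z ↦ D · z` on cycles, extended linearly. -/
def Complements.act (P : F.Complements) (D : F.QCartier) : F.Cycles →ₗ[ℚ] F.Cycles :=
  Finsupp.linearCombination ℚ (P.actOn D)

/-! ### The ring of cycles -/

/-- A bilinear product on `Z_*(X)_ℚ` is the intersection product attached to the choice of
complements if it is commutative, associative, has unit `[X]`, and the product of the cycle of a
`ℚ`-Cartier divisor with a cycle is given by the action of that divisor. -/
structure Complements.IsIntersectionProduct (P : F.Complements)
    (mul : F.Cycles →ₗ[ℚ] F.Cycles →ₗ[ℚ] F.Cycles) : Prop where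
  comm : ∀ a b, mul a b = mul b a
  assoc : ∀ a b c, mul (mul a b) c = mul a (mul b c)
  one : ∀ a, mul F.fundamentalCycle a = a
  divisor : ∀ (D : F.QCartier) (z : F.Cycles), mul (divisorCycle D) z = P.act D z

namespace Complements.IsIntersectionProduct

variable {P : F.Complements} {mul : F.Cycles →ₗ[ℚ] F.Cycles →ₗ[ℚ] F.Cycles}

/-- The space `Z_*(X)_ℚ`, regarded as a ring by means of the intersection product. -/
def CycleRing (_ : P.IsIntersectionProduct mul) : Type _ := F.Cycles

/-- The class in the ring of a cycle. -/
def ofCycle (h : P.IsIntersectionProduct mul) (z : F.Cycles) : h.CycleRing := z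

instance (h : P.IsIntersectionProduct mul) : AddCommGroup h.CycleRing :=
  inferInstanceAs (AddCommGroup F.Cycles)

instance (h : P.IsIntersectionProduct mul) : Module ℚ h.CycleRing :=
  inferInstanceAs (Module ℚ F.Cycles)

instance (h : P.IsIntersectionProduct mul) : CommRing h.CycleRing :=
  { (inferInstance : AddCommGroup h.CycleRing) with
    mul := fun a b => mul a b
    one := F.fundamentalCycle
    mul_assoc := h.assoc
    mul_comm := h.comm
    one_mul := h.one
    mul_one := fun a => (h.comm a _).trans (h.one a)
    left_distrib := fun a b c => (mul a).map_add b c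
    right_distrib := LinearMap.map_add₂ mul
    zero_mul := LinearMap.map_zero₂ mul
    mul_zero := fun a => (mul a).map_zero }

instance (h : P.IsIntersectionProduct mul) : Algebra ℚ h.CycleRing :=
  Algebra.ofModule
    (LinearMap.map_smul₂ mul)
    (fun r a b => (mul a).map_smul r b)

/-- The ring homomorphism `α : ℚ[Y_1, …, Y_r] → Z_*(X)_ℚ` that sends `Y_i` to `D_i = [V(ρ_i)]`. -/
def α (h : P.IsIntersectionProduct mul) : MvPolynomial F.Ray ℚ →ₐ[ℚ] h.CycleRing :=
  MvPolynomial.aeval fun ρ => h.ofCycle (V ρ.1)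

end Complements.IsIntersectionProduct

variable (F) in
/-- The Stanley–Reisner ideal `I_Σ`, generated by the products of variables whose rays are not
all contained in some cone of the fan. -/
def stanleyReisner : Ideal (MvPolynomial F.Ray ℚ) :=
  Ideal.span {p | ∃ S : Finset F.Ray,
    (¬ ∃ σ ∈ F.cones, ∀ ρ ∈ S, (ρ : Cone N) ≤ σ) ∧ p = ∏ ρ ∈ S, MvPolynomial.X ρ}

end Fan

/-! ### The action defined by an inner product -/

/-- An inner product on a rational vector space. -/
structure InnerProduct (W : Type*) [AddCommGroup W] [Module ℚ W] where
  /-- the underlying bilinear form -/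
  form : LinearMap.BilinForm ℚ W
  symm : ∀ x y, form x y = form y x
  pos : ∀ x, x ≠ 0 → 0 < form x x

namespace InnerProduct

theorem isRefl {W : Type*} [AddCommGroup W] [Module ℚ W] (B : InnerProduct W) :
    B.form.IsRefl := fun x y h => by rw [B.symm, h]

theorem nondegenerate {W : Type*} [AddCommGroup W] [Module ℚ W] (B : InnerProduct W) :
    B.form.Nondegenerate := by
  constructor <;> intro x hx <;> by_contra hne
  · exact (B.pos x hne).ne' (hx x)
  · exact (B.pos x hne).ne' (hx x)

theorem isCompl_orthogonal {W : Type*} [AddCommGroup W] [Module ℚ W] [FiniteDimensional ℚ W]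
    (B : InnerProduct W) (U : Submodule ℚ W) : IsCompl U (B.form.orthogonal U) := by
  rw [LinearMap.BilinForm.isCompl_orthogonal_iff_disjoint B.isRefl, Submodule.disjoint_def]
  intro x hx hx'
  by_contra hne
  exact (B.pos x hne).ne' (hx' x hx)

variable {N : Type*} [AddCommGroup N] [Module.Free ℤ N] [Module.Finite ℤ N]

/-- The choice of complements induced by an inner product on `M`: `Ψ(σ)` is the orthogonal
complement of `σ^⊥`. -/
def complements (B : InnerProduct (MQ N)) (F : Fan N) : F.Complements where
  Ψ := fun σ => B.form.orthogonal (perp (σ : Cone N))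
  isCompl := fun _ => B.isCompl_orthogonal _
  mono := fun _ _ h => LinearMap.BilinForm.orthogonal_le (perp_anti h.le)

/-- The isomorphism `ω : N_ℚ → M_ℚ` defined by `⟨m, ω(v)⟩_M = ⟨m, v⟩`. -/
def ω (B : InnerProduct (MQ N)) : NQ N ≃ₗ[ℚ] MQ N :=
  (Module.evalEquiv ℚ (NQ N)).trans (B.form.toDual B.nondegenerate).symm

theorem form_ω (B : InnerProduct (MQ N)) (m : MQ N) (v : NQ N) : B.form m (B.ω v) = m v := by
  rw [B.symm, ω, LinearEquiv.trans_apply, LinearMap.BilinForm.apply_toDual_symm_apply]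
  rfl

/-- The ideal `J`, generated by the elements `∑_j ⟨ω(v_j), v_i⟩ Y_i Y_j`, one for each ray
`ρ_i`. -/
def quadraticIdeal (B : InnerProduct (MQ N)) (F : Fan N) : Ideal (MvPolynomial F.Ray ℚ) :=
  Ideal.span (Set.range fun i : F.Ray => ∑ j : F.Ray,
    MvPolynomial.C (B.ω (ι (primitive (j : Cone N))) (ι (primitive (i : Cone N)))) *
      (MvPolynomial.X i * MvPolynomial.X j))

end InnerProduct

end ToricCycle

end

/-! In a simplicial fan the cones form a simplicial complex on the rays (`exists_rays_eq`), and a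
divisor is an arbitrary function on the rays (`coordEquiv`). The inner product moves to `N_ℚ`
through `ω`, and pairing with `π_σ(m)` becomes evaluation of `m` on vectors projected orthogonally
off the span of `σ` (`apply_offSpan`).

The crux is that the operators of divisors commute (`act_comm`). The coefficient of `[V(γ)]` in `D ·
(E · [V(σ)])` is a sum over the two cones between `σ` and `γ`. The lattice factors along both paths
have the same product, a determinant attached to `N_γ / N_σ` (`scale_mul_scale_eq`), and one
Gram–Schmidt step (`offSpan_insert`) makes what remains symmetric in `D` and `E`.

Hence `ℚ[Y_1, …, Y_r]` acts on cycles, `Y_i` acting as `D_i`. Square-free face monomials send `[X]`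
to nonzero multiples of the basis cycles, so the module is cyclic, and a cyclic module over a
commutative ring has a unique product compatible with the action and with the generator as unit. The
kernel of `α` is the annihilator of `[X]`. It contains `I_Σ` because products over non-faces vanish,
and `J` because `∑_j ⟨ω(v_j), v_i⟩ D_j` is the principal divisor of `ω(v_i)`, which is orthogonal to
`M(σ)` for every `σ` containing `v_i`. Conversely, invertibility of Gram matrices lets `J` remove
repeated variables, so face monomials span modulo `I_Σ + J` (`span_sup_eq_top`); their images are
linearly independent, which leaves no room for a larger kernel. -/

noncomputable section

namespace ToricCycle

/-! ### Coordinate forms and simplicial cones -/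

section LinearAlgebra

variable {V I : Type*} [AddCommGroup V] [Module ℚ V]

theorem exists_dual_eq_on {b : I → V} {S : Set I} (h : LinearIndepOn ℚ b S) (c : I → ℚ) :
    ∃ m : Module.Dual ℚ V, ∀ i ∈ S, m (b i) = c i := by
  let B := Module.Basis.span (R := ℚ) (v := fun i : S => b i) h
  obtain ⟨g, hg⟩ := LinearMap.exists_extend (B.constr ℚ (fun i : S => c i))
  refine ⟨g, fun i hi => ?_⟩
  have h1 := LinearMap.congr_fun hg (B ⟨i, hi⟩)
  rw [Module.Basis.constr_basis, LinearMap.comp_apply, Submodule.subtype_apply] at h1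
  rw [← h1]
  exact congrArg g (congrArg Subtype.val (Module.Basis.span_apply h ⟨i, hi⟩).symm)

theorem apply_sum_of_eq_ite [DecidableEq I] {b : I → V} {S : Finset I} {m : Module.Dual ℚ V}
    {i : I} (hm : ∀ j ∈ S, m (b j) = if j = i then 1 else 0) (c : I → ℚ) :
    m (∑ j ∈ S, c j • b j) = if i ∈ S then c i else 0 := by
  rw [map_sum, Finset.sum_congr rfl (g := fun j => if j = i then c j else 0)]
  · simp
  · intro j hj
    rw [map_smul, hm j hj, smul_eq_mul, mul_ite, mul_one, mul_zero]

theorem mem_hull_image_finset {b : I → V} {S : Finset I} {x : V} :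
    x ∈ PointedCone.hull ℚ (b '' S) ↔ ∃ c : I → ℚ, (∀ i, 0 ≤ c i) ∧ x = ∑ i ∈ S, c i • b i := by
  rw [PointedCone.hull, Submodule.mem_span_image_finset_iff_exists_fun']
  constructor
  · rintro ⟨c, rfl⟩
    exact ⟨fun i => c i, fun i => (c i).2, rfl⟩
  · rintro ⟨c, hc, rfl⟩
    exact ⟨fun i => ⟨c i, hc i⟩, rfl⟩

theorem span_hull (s : Set V) :
    Submodule.span ℚ (PointedCone.hull ℚ s : Set V) = Submodule.span ℚ s :=
  le_antisymm (Submodule.span_le.2 fun _ hx => PointedCone.hull_le_span ℚ s hx)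
    (Submodule.span_mono PointedCone.subset_hull)

/-- Coordinates with respect to independent generators are unique and nonnegative on the cone, so
those outside `S` vanish for a summand as soon as they vanish for the sum. -/
theorem isFaceOf_hull_image {b : I → V} {S T : Finset I} (h : LinearIndepOn ℚ b (T : Set I))
    (hST : S ⊆ T) : (PointedCone.hull ℚ (b '' S)).IsFaceOf (PointedCone.hull ℚ (b '' T)) := by
  classical
  refine PointedCone.IsFaceOf.of_mem_of_add_mem_left
    (Submodule.span_mono (Set.image_mono (by exact_mod_cast hST))) ?_
  intro x y hx hy hxy
  obtain ⟨c, hc, rfl⟩ := mem_hull_image_finset.1 hx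
  obtain ⟨d, hd, rfl⟩ := mem_hull_image_finset.1 hy
  obtain ⟨e, he, hsum⟩ := mem_hull_image_finset.1 hxy
  have key : ∀ i ∈ T, i ∉ S → c i = 0 := by
    intro i hi hiS
    obtain ⟨m, hm⟩ := exists_dual_eq_on h (fun j => if j = i then 1 else 0)
    have h1 := congrArg m hsum
    have hm' : ∀ j ∈ T, m (b j) = if j = i then 1 else 0 := hm
    rw [map_add, apply_sum_of_eq_ite hm', apply_sum_of_eq_ite hm',
      apply_sum_of_eq_ite fun j hj => hm' j (hST hj), if_pos hi, if_pos hi, if_neg hiS] at h1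
    linarith [hc i, hd i]
  refine mem_hull_image_finset.2 ⟨c, hc, ?_⟩
  exact (Finset.sum_subset hST fun i hi hiS => by rw [key i hi hiS, zero_smul]).symm

end LinearAlgebra

/-! ### Lattice points of cones and normal vectors -/

section Lattice

variable {N : Type*} [AddCommGroup N]

/-- The embedding `N → N_ℚ` as a homomorphism. -/
def ιHom : N →+ NQ N where
  toFun := ι
  map_zero' := by simp [ι]
  map_add' := fun x y => by simp [ι, TensorProduct.tmul_add]

theorem ι_zero : ι (0 : N) = 0 := (ιHom (N := N)).map_zero

theorem ι_add (x y : N) : ι (x + y) = ι x + ι y := (ιHom (N := N)).map_add x y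

theorem ι_nsmul (k : ℕ) (x : N) : ι (k • x) = (k : ℚ) • ι x := by
  rw [Nat.cast_smul_eq_nsmul]; exact (ιHom (N := N)).map_nsmul k x

theorem ι_zsmul (k : ℤ) (x : N) : ι (k • x) = (k : ℚ) • ι x := by
  rw [Int.cast_smul_eq_zsmul]; exact (ιHom (N := N)).map_zsmul k x

theorem exists_nsmul_eq_ι (x : NQ N) : ∃ k : ℕ, 0 < k ∧ ∃ n : N, ι n = (k : ℚ) • x := by
  induction x using TensorProduct.induction_on with
  | zero => exact ⟨1, one_pos, 0, by simp [ι_zero]⟩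
  | tmul q n =>
    refine ⟨q.den, q.den_pos, q.num • n, ?_⟩
    rw [ι_zsmul, ι, TensorProduct.smul_tmul', TensorProduct.smul_tmul', smul_eq_mul, smul_eq_mul,
      mul_one, Rat.den_mul_eq_num]
  | add x y hx hy =>
    obtain ⟨k, hk, n, hn⟩ := hx
    obtain ⟨l, hl, m, hm⟩ := hy
    refine ⟨k * l, Nat.mul_pos hk hl, l • n + k • m, ?_⟩
    rw [ι_add, ι_nsmul, ι_nsmul, hn, hm, smul_smul, smul_smul, smul_add]
    push_cast
    rw [mul_comm (l : ℚ)]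

theorem ι_mem_linSpan {σ : Cone N} {n : N} (hn : n ∈ latticeSpan σ) : ι n ∈ linSpan σ := by
  refine (AddSubgroup.closure_le
    ((linSpan σ).toAddSubgroup.comap (ιHom (N := N)))).2 ?_ hn
  intro x hx
  exact Submodule.subset_span hx

theorem perp_apply {σ : Cone N} {m : MQ N} (hm : m ∈ perp σ) {x : NQ N} (hx : x ∈ linSpan σ) :
    m x = 0 := by
  have : linSpan σ ≤ LinearMap.ker m := Submodule.span_le.2 fun y hy => hm y hy
  exact this hx

theorem mem_latticeSpan_of_le {σ τ : Cone N} (h : σ ≤ τ) : latticeSpan σ ≤ latticeSpan τ :=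
  AddSubgroup.closure_mono fun _ hx => h hx

/-- A vector in the linear span of a cone lies in the cone after adding a suitable lattice point
of the cone. -/
theorem exists_ι_add_mem {σ : Cone N} {x : NQ N} (hx : x ∈ linSpan σ) :
    ∃ n : N, ι n ∈ σ ∧ x + ι n ∈ σ := by
  unfold linSpan at hx
  induction hx using Submodule.span_induction with
  | mem x hx => exact ⟨0, by rw [ι_zero]; exact zero_mem _, by rw [ι_zero, add_zero]; exact hx⟩
  | zero => exact ⟨0, by rw [ι_zero]; exact zero_mem _, by rw [ι_zero, add_zero]; exact zero_mem _⟩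
  | add x y _ _ hx hy =>
    obtain ⟨n, h1, h2⟩ := hx
    obtain ⟨m, h3, h4⟩ := hy
    refine ⟨n + m, by rw [ι_add]; exact add_mem h1 h3, ?_⟩
    rw [ι_add, add_add_add_comm]
    exact add_mem h2 h4
  | smul a x _ hx =>
    obtain ⟨n, h1, h2⟩ := hx
    obtain ⟨l, hl⟩ : ∃ l : ℕ, |a| ≤ l := exists_nat_ge _
    by_cases ha : 0 ≤ a
    · rw [abs_of_nonneg ha] at hl
      refine ⟨l • n, by rw [ι_nsmul]; exact σ.smul_mem (Nat.cast_nonneg l) h1, ?_⟩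
      have : a • x + ι (l • n) = a • (x + ι n) + ((l : ℚ) - a) • ι n := by
        rw [ι_nsmul]; module
      rw [this]
      exact add_mem (PointedCone.smul_mem σ ha h2) (PointedCone.smul_mem σ (sub_nonneg.2 hl) h1)
    · push Not at ha
      rw [abs_of_neg ha] at hl
      -- For negative `a` the correction must dominate `|a| x`. A multiple of `x + ι n` does, but
      -- that vector need not be integral, so denominators are cleared first.
      obtain ⟨k, hk, p, hp⟩ := exists_nsmul_eq_ι (x + ι n)
      have hp' : ι p ∈ σ := by rw [hp]; exact PointedCone.smul_mem σ (Nat.cast_nonneg k) h2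
      refine ⟨l • p, by rw [ι_nsmul]; exact PointedCone.smul_mem σ (Nat.cast_nonneg l) hp', ?_⟩
      have : a • x + ι (l • p) = ((l : ℚ) * k + a) • (x + ι n) + (-a) • ι n := by
        rw [ι_nsmul, hp]; module
      rw [this]
      have hk1 : (1 : ℚ) ≤ k := by exact_mod_cast hk
      have hlk : -a ≤ (l : ℚ) * k := hl.trans (le_mul_of_one_le_right (Nat.cast_nonneg l) hk1)
      exact add_mem (PointedCone.smul_mem σ (by linarith) h2)
        (PointedCone.smul_mem σ (by linarith) h1)

/-- `N_σ` is saturated: a lattice point of the span is the difference of two lattice points of the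
cone. -/
theorem mem_latticeSpan {σ : Cone N} {n : N} : n ∈ latticeSpan σ ↔ ι n ∈ linSpan σ := by
  refine ⟨ι_mem_linSpan, fun h => ?_⟩
  obtain ⟨m, h1, h2⟩ := exists_ι_add_mem h
  rw [← ι_add] at h2
  have := sub_mem (AddSubgroup.subset_closure h2 : n + m ∈ latticeSpan σ)
    (AddSubgroup.subset_closure h1 : m ∈ latticeSpan σ)
  rwa [add_sub_cancel_right] at this

/-- A linear form takes values in `(1/d)ℤ` on a finitely generated group. -/
theorem exists_common_denominator [Module.Finite ℤ N] (m : MQ N) :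
    ∃ d : ℕ, 0 < d ∧ ∀ n : N, ∃ z : ℤ, (d : ℚ) * m (ι n) = z := by
  obtain ⟨s, hs⟩ := (Module.Finite.fg_top : (⊤ : Submodule ℤ N).FG)
  refine ⟨∏ n ∈ s, (m (ι n)).den, Finset.prod_pos fun n _ => Rat.den_pos _, fun n => ?_⟩
  have hn : n ∈ Submodule.span ℤ (s : Set N) := hs ▸ Submodule.mem_top
  induction hn using Submodule.span_induction with
  | mem x hx =>
    obtain ⟨k, hk⟩ := Finset.dvd_prod_of_mem (fun n => (m (ι n)).den) hx
    refine ⟨k * (m (ι x)).num, ?_⟩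
    rw [hk]
    push_cast
    rw [mul_comm ((m (ι x)).den : ℚ), mul_assoc, Rat.den_mul_eq_num]
  | zero => exact ⟨0, by simp [ι_zero]⟩
  | add x y _ _ hx hy =>
    obtain ⟨a, ha⟩ := hx
    obtain ⟨b, hb⟩ := hy
    exact ⟨a + b, by rw [ι_add, map_add, mul_add, ha, hb]; push_cast; rfl⟩
  | smul c x _ hx =>
    obtain ⟨a, ha⟩ := hx
    refine ⟨c * a, ?_⟩
    rw [ι_zsmul, map_smul, smul_eq_mul, mul_left_comm, ha]; push_cast; rfl

/-- The form `m` is the coordinate along `v` modulo the span of `σ`. A multiple `ψ` of it is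
integral, so `ψ(N_τ)` is cyclic, and a preimage of a generator generates `N_τ` modulo `ker m ∩ N_τ`,
which lies in `N_σ` by saturation. -/
theorem exists_isNormalVector [Module.Finite ℤ N] {σ τ : Cone N} {v : NQ N} (m : MQ N)
    (hστ : σ ≤ τ) (hv : v ∈ τ)
    (hm : ∀ x ∈ linSpan τ, x - m x • v ∈ linSpan σ) :
    ∃ n, IsNormalVector τ σ n := by
  obtain ⟨d, hd, hz⟩ := exists_common_denominator m
  have hd' : (0 : ℚ) < d := by exact_mod_cast hd
  choose z hz using hz
  let ψ : N →+ ℤ := AddMonoidHom.mk' z fun x y => by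
    have : ((z (x + y) : ℤ) : ℚ) = ((z x + z y : ℤ) : ℚ) := by
      push_cast; rw [← hz, ← hz, ← hz, ι_add, map_add, mul_add]
    exact_mod_cast this
  have hψ : ∀ x, (d : ℚ) * m (ι x) = ψ x := hz
  obtain ⟨g, hg⟩ := Int.subgroup_cyclic ((latticeSpan τ).map ψ)
  have hgen : ∃ n ∈ latticeSpan τ, 0 ≤ ψ n ∧ ∀ x ∈ latticeSpan τ, ∃ k : ℤ, ψ x = k * ψ n := by
    have h1 : g ∈ (latticeSpan τ).map ψ := hg ▸ AddSubgroup.subset_closure rfl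
    obtain ⟨n, hn, rfl⟩ := h1
    have h2 : ∀ x ∈ latticeSpan τ, ∃ k : ℤ, ψ x = k * ψ n := by
      intro x hx
      have : ψ x ∈ (latticeSpan τ).map ψ := AddSubgroup.mem_map_of_mem _ hx
      rw [hg, AddSubgroup.mem_closure_singleton] at this
      obtain ⟨k, hk⟩ := this
      exact ⟨k, by rw [← hk, smul_eq_mul]⟩
    -- The sign is chosen so that `m (ι n) • v` lies in the cone `τ`.
    rcases le_total 0 (ψ n) with h0 | h0
    · exact ⟨n, hn, h0, h2⟩
    · refine ⟨-n, neg_mem hn, by rw [map_neg]; omega, fun x hx => ?_⟩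
      obtain ⟨k, hk⟩ := h2 x hx
      exact ⟨-k, by rw [map_neg, hk]; ring⟩
  obtain ⟨n, hn, hpos, hk⟩ := hgen
  refine ⟨n, le_antisymm ?_ (sup_le (mem_latticeSpan_of_le hστ) ?_), m (ι n) • v, ?_, ?_⟩
  · intro x hx
    obtain ⟨k, hk⟩ := hk x hx
    have hmx : m (ι (x - k • n)) = 0 := by
      have : (d : ℚ) * m (ι (x - k • n)) = 0 := by
        rw [hψ, map_sub, map_zsmul, hk, smul_eq_mul, sub_self, Int.cast_zero]
      exact (mul_eq_zero.1 this).resolve_left hd'.ne'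
    have h1 : x - k • n ∈ latticeSpan σ := by
      rw [mem_latticeSpan]
      have := hm _ (ι_mem_linSpan (sub_mem hx (zsmul_mem hn k)))
      rwa [hmx, zero_smul, sub_zero] at this
    rw [← sub_add_cancel x (k • n)]
    exact add_mem (AddSubgroup.mem_sup_left h1)
      (AddSubgroup.mem_sup_right (AddSubgroup.zsmul_mem_zmultiples n k))
  · rw [AddSubgroup.zmultiples_le]; exact hn
  · refine PointedCone.smul_mem τ ?_ hv
    have : (0 : ℚ) ≤ d * m (ι n) := by rw [hψ]; exact_mod_cast hpos
    exact nonneg_of_mul_nonneg_right this hd'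
  · exact hm _ (ι_mem_linSpan hn)

/-- If `m` vanished on `n` it would vanish on all of `N_τ`, which contains a positive multiple of
`v`. -/
theorem IsNormalVector.pos {σ τ : Cone N} {v : NQ N} {m : MQ N} {n : N}
    (hn : IsNormalVector τ σ n) (hv : v ∈ τ) (hmv : m v = 1)
    (hmτ : ∀ x ∈ τ, 0 ≤ m x) (hmσ : ∀ x ∈ linSpan σ, m x = 0) :
    0 < m (ι n) := by
  obtain ⟨h1, x, hx, hx'⟩ := hn
  have hmx : m (ι n) = m x := by
    have := hmσ _ hx'
    rw [map_sub] at this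
    linarith
  refine lt_of_le_of_ne (hmx ▸ hmτ x hx) fun h0 => ?_
  obtain ⟨k, hk, p, hp⟩ := exists_nsmul_eq_ι v
  have hpτ : p ∈ latticeSpan τ :=
    AddSubgroup.subset_closure (by
      rw [Set.mem_ofPred_eq, hp]; exact PointedCone.smul_mem τ (Nat.cast_nonneg k) hv)
  rw [h1] at hpτ
  obtain ⟨a, ha, b, hb, rfl⟩ := AddSubgroup.mem_sup.1 hpτ
  obtain ⟨l, rfl⟩ := AddSubgroup.mem_zmultiples_iff.1 hb
  have := congrArg m hp
  rw [ι_add, map_add, ι_zsmul, map_smul, map_smul, ← h0, hmσ _ (ι_mem_linSpan ha), hmv] at this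
  simp only [smul_eq_mul, mul_one, mul_zero, zero_add] at this
  exact hk.ne (by exact_mod_cast this)

/-- Of two bases of a rank two lattice that are adapted to two coordinate axes, the first has at
most the determinant of the second. -/
theorem mul_le_mul_of_isNormalVector {σ τ γ : Cone N} {e f e' f' : N} {x y : MQ N}
    (he : IsNormalVector τ σ e) (hf : IsNormalVector γ τ f)
    (he' : e' ∈ latticeSpan γ) (hf' : f' ∈ latticeSpan γ)
    (hx : x ∈ perp σ) (hy : y ∈ perp τ) (hxe' : x (ι e') = 0)
    (hpos : 0 < x (ι e) * y (ι f)) (hpos' : 0 < y (ι e') * x (ι f')) :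
    x (ι e) * y (ι f) ≤ y (ι e') * x (ι f') := by
  have key : ∀ n ∈ latticeSpan γ, ∃ p q : ℤ,
      x (ι n) = p * x (ι e) + q * x (ι f) ∧ y (ι n) = q * y (ι f) := by
    intro n hn
    rw [hf.1, he.1] at hn
    obtain ⟨n₁, hn₁, b, hb, rfl⟩ := AddSubgroup.mem_sup.1 hn
    obtain ⟨n₂, hn₂, a, ha, rfl⟩ := AddSubgroup.mem_sup.1 hn₁
    obtain ⟨q, rfl⟩ := AddSubgroup.mem_zmultiples_iff.1 hb
    obtain ⟨p, rfl⟩ := AddSubgroup.mem_zmultiples_iff.1 ha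
    refine ⟨p, q, ?_, ?_⟩
    · rw [ι_add, ι_add, map_add, map_add, ι_zsmul, ι_zsmul, map_smul, map_smul,
        perp_apply_eq_zero hx hn₂, zero_add, smul_eq_mul, smul_eq_mul]
    · rw [ι_add, map_add, ι_zsmul, map_smul,
        perp_apply_eq_zero hy (he.1 ▸ hn₁), zero_add, smul_eq_mul]
  obtain ⟨p, q, h1, h2⟩ := key e' he'
  obtain ⟨r, s, h3, h4⟩ := key f' hf'
  -- Modulo the kernels of `x` and `y`, the pair `e', f'` is an integral combination of `e, f`.
  -- Since `x (ι e') = 0`, comparing determinants leaves a single product on each side; positivity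
  -- then makes the integer factor at least `1`.
  have hdet : y (ι e') * x (ι f') = ((q * r - p * s : ℤ) : ℚ) * (x (ι e) * y (ι f)) := by
    rw [hxe'] at h1
    rw [h2, h3]
    push_cast
    linear_combination (-s * y (ι f)) * h1
  rw [hdet] at hpos' ⊢
  have hk : (0 : ℚ) < ((q * r - p * s : ℤ) : ℚ) := pos_of_mul_pos_left hpos' hpos.le
  have hk' : (1 : ℚ) ≤ ((q * r - p * s : ℤ) : ℚ) := by
    have : 0 < q * r - p * s := by exact_mod_cast hk
    exact_mod_cast this
  exact le_mul_of_one_le_left hpos.le hk'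

end Lattice

/-! ### Normal vectors of simplicial cones -/

section

variable {N : Type*} [AddCommGroup N]

theorem linSpan_hull (s : Set (NQ N)) :
    linSpan (PointedCone.hull ℚ s) = Submodule.span ℚ s := span_hull s

theorem dim_hull_singleton {x : NQ N} (hx : x ≠ 0) : dim (PointedCone.hull ℚ {x}) = 1 := by
  rw [dim, linSpan_hull]
  exact finrank_span_singleton hx

theorem mem_hull_singleton {x y : NQ N} :
    y ∈ PointedCone.hull ℚ {x} ↔ ∃ c : ℚ, 0 ≤ c ∧ y = c • x := by
  rw [PointedCone.hull, Submodule.mem_span_singleton]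
  constructor
  · rintro ⟨c, rfl⟩; exact ⟨c, c.2, rfl⟩
  · rintro ⟨c, hc, rfl⟩; exact ⟨⟨c, hc⟩, rfl⟩

theorem hull_singleton_smul {x : NQ N} {c : ℚ} (hc : 0 < c) :
    PointedCone.hull ℚ {c • x} = PointedCone.hull ℚ {x} := by
  ext y
  rw [mem_hull_singleton, mem_hull_singleton]
  constructor
  · rintro ⟨d, hd, rfl⟩; exact ⟨d * c, by positivity, by rw [mul_smul]⟩
  · rintro ⟨d, hd, rfl⟩
    exact ⟨d / c, by positivity, by rw [smul_smul, div_mul_cancel₀ _ hc.ne']⟩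

/-- The coordinate form of `b a` on the span of `T` supplies the `m` required by
`exists_isNormalVector` and `IsNormalVector.pos`; the factor `c` is its value at the normal vector.
-/
theorem ι_normalVector_hull {I : Type*} [Module.Finite ℤ N] {b : I → NQ N} {S T : Finset I}
    {a : I} (hT : ∀ i, i ∈ T ↔ i = a ∨ i ∈ S) (ha : a ∉ S) (hli : LinearIndepOn ℚ b (T : Set I)) :
    IsNormalVector (PointedCone.hull ℚ (b '' T)) (PointedCone.hull ℚ (b '' S))
      (normalVector (PointedCone.hull ℚ (b '' T)) (PointedCone.hull ℚ (b '' S))) ∧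
    ∃ c : ℚ, 0 < c ∧
      ι (normalVector (PointedCone.hull ℚ (b '' T)) (PointedCone.hull ℚ (b '' S))) - c • b a ∈
        linSpan (PointedCone.hull ℚ (b '' S)) := by
  classical
  have haT : a ∈ T := (hT a).2 (Or.inl rfl)
  have hST : (S : Set I) ⊆ T := fun i hi => (hT i).2 (Or.inr hi)
  have hTS : T = insert a S := by ext i; rw [hT, Finset.mem_insert]
  obtain ⟨m, hm⟩ := exists_dual_eq_on hli (fun j => if j = a then 1 else 0)
  have hm' : ∀ j ∈ T, m (b j) = if j = a then 1 else 0 := hm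
  have hv : b a ∈ PointedCone.hull ℚ (b '' T) :=
    PointedCone.subset_hull (Set.mem_image_of_mem b haT)
  have hmv : m (b a) = 1 := by rw [hm' a haT, if_pos rfl]
  have hle : PointedCone.hull ℚ (b '' S) ≤ PointedCone.hull ℚ (b '' T) :=
    Submodule.span_mono (Set.image_mono hST)
  have hres : ∀ x ∈ linSpan (PointedCone.hull ℚ (b '' T)),
      x - m x • b a ∈ linSpan (PointedCone.hull ℚ (b '' S)) := by
    intro x hx
    rw [linSpan_hull, Submodule.mem_span_image_finset_iff_exists_fun'] at hx ⊢
    obtain ⟨c, rfl⟩ := hx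
    refine ⟨c, ?_⟩
    rw [apply_sum_of_eq_ite hm', if_pos haT, hTS, Finset.sum_insert ha, add_sub_cancel_left]
  have hmS : ∀ x ∈ linSpan (PointedCone.hull ℚ (b '' S)), m x = 0 := by
    intro x hx
    rw [linSpan_hull, Submodule.mem_span_image_finset_iff_exists_fun'] at hx
    obtain ⟨c, rfl⟩ := hx
    rw [apply_sum_of_eq_ite (fun j hj => hm' j (hST hj)), if_neg ha]
  have hmT : ∀ x ∈ PointedCone.hull ℚ (b '' T), 0 ≤ m x := by
    intro x hx
    obtain ⟨c, hc, rfl⟩ := mem_hull_image_finset.1 hx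
    rw [apply_sum_of_eq_ite hm', if_pos haT]
    exact hc a
  have hex := exists_isNormalVector m hle hv hres
  have hnv : IsNormalVector (PointedCone.hull ℚ (b '' T)) (PointedCone.hull ℚ (b '' S))
      (normalVector (PointedCone.hull ℚ (b '' T)) (PointedCone.hull ℚ (b '' S))) := by
    rw [normalVector, dif_pos hex]
    exact hex.choose_spec
  exact ⟨hnv, _, hnv.pos hv hmv hmT hmS, hres _ (ι_mem_linSpan (normalVector_mem _ _))⟩

theorem exists_generator_of_dim_eq_one {ρ : Cone N} (h : PointedCone.IsSimplicial ρ)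
    (hd : dim ρ = 1) : ∃ x : NQ N, x ≠ 0 ∧ ρ = PointedCone.hull ℚ {x} := by
  obtain ⟨s, hs, hli, rfl⟩ := h
  rw [dim, linSpan_hull] at hd
  have hli' : LinearIndependent ℚ ((↑) : s → NQ N) := hli
  have := hs.fintype
  rw [finrank_span_set_eq_card hli', Finset.card_eq_one] at hd
  obtain ⟨x, hx⟩ := hd
  have hsx : s = {x} := by
    rw [← Set.coe_toFinset s, hx, Finset.coe_singleton]
  subst hsx
  exact ⟨x, hli'.ne_zero ⟨x, rfl⟩, rfl⟩

/-- This is the case `S = ∅` of `ι_normalVector_hull`: the span of the facet is zero, so the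
congruence is an equality. -/
theorem exists_ι_primitive [Module.Finite ℤ N] {x : NQ N} (hx : x ≠ 0) :
    ∃ c : ℚ, 0 < c ∧ ι (primitive (PointedCone.hull ℚ {x})) = c • x := by
  have hli : LinearIndepOn ℚ (id : NQ N → NQ N) (({x} : Finset (NQ N)) : Set (NQ N)) := by
    rw [Finset.coe_singleton, linearIndepOn_singleton_iff]; exact hx
  obtain ⟨-, c, hc, h⟩ := ι_normalVector_hull (S := ∅) (T := {x}) (a := x)
    (fun i => by simp) (by simp) hli
  refine ⟨c, hc, ?_⟩
  rw [linSpan_hull, Finset.coe_empty, Set.image_empty, Submodule.span_empty, Submodule.mem_bot,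
    PointedCone.hull, PointedCone.hull, Submodule.span_empty, Finset.coe_singleton,
    Set.image_singleton] at h
  exact sub_eq_zero.1 h

end

/-! ### The simplicial complex of a simplicial fan -/

namespace Fan

variable {N : Type*} [AddCommGroup N] {F : Fan N}

/-- The generator of a ray in `N_ℚ`: its first lattice point. -/
def gen (ρ : F.Ray) : NQ N := ι (primitive (ρ : Cone N))

open scoped Classical in
/-- The rays of a cone of the fan. -/
def rays (σ : F.cones) : Finset F.Ray := Finset.univ.filter fun ρ => (ρ : Cone N) ≤ σ

theorem mem_rays {σ : F.cones} {ρ : F.Ray} : ρ ∈ rays σ ↔ (ρ : Cone N) ≤ σ := by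
  simp [rays]

theorem isFaceOf_of_le {σ τ : F.cones} (h : (σ : Cone N) ≤ τ) : (σ : Cone N).IsFaceOf τ := by
  have := (F.inter_isFaceOf σ σ.2 τ τ.2).2
  rwa [inf_eq_left.2 h] at this

variable [Module.Finite ℤ N]

theorem gen_ne_zero_and_hull_gen (hF : F.IsSimplicial) (ρ : F.Ray) :
    gen ρ ≠ 0 ∧ (ρ : Cone N) = PointedCone.hull ℚ {gen ρ} := by
  obtain ⟨x, hx, h⟩ := exists_generator_of_dim_eq_one (hF ρ ρ.1.2) ρ.2
  obtain ⟨c, hc, h'⟩ := exists_ι_primitive hx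
  rw [gen, h, h']
  exact ⟨smul_ne_zero hc.ne' hx, (hull_singleton_smul hc).symm⟩

theorem gen_ne_zero (hF : F.IsSimplicial) (ρ : F.Ray) : gen ρ ≠ 0 :=
  (gen_ne_zero_and_hull_gen hF ρ).1

theorem coe_ray_eq (hF : F.IsSimplicial) (ρ : F.Ray) :
    (ρ : Cone N) = PointedCone.hull ℚ {gen ρ} :=
  (gen_ne_zero_and_hull_gen hF ρ).2

theorem gen_mem (hF : F.IsSimplicial) (ρ : F.Ray) : gen ρ ∈ (ρ : Cone N) :=
  (coe_ray_eq hF ρ).ge (PointedCone.subset_hull rfl)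

theorem gen_mem_iff (hF : F.IsSimplicial) {ρ : F.Ray} {σ : Cone N} :
    gen ρ ∈ σ ↔ (ρ : Cone N) ≤ σ := by
  refine ⟨fun h => ?_, fun h => h (gen_mem hF ρ)⟩
  rw [coe_ray_eq hF ρ]
  exact Submodule.span_le.2 (Set.singleton_subset_iff.2 h)

/-- A cone of a simplicial fan is generated by a linearly independent set, whose elements are
positive multiples of the first lattice points of the rays. -/
theorem coe_eq_hull_and_linearIndepOn (hF : F.IsSimplicial) (σ : F.cones) :
    (σ : Cone N) = PointedCone.hull ℚ (gen '' (rays σ : Set F.Ray)) ∧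
      LinearIndepOn ℚ (gen (F := F)) (rays σ : Set F.Ray) := by
  classical
  obtain ⟨s, hs, hli, hσ⟩ := hF σ σ.2
  have hli' : LinearIndependent ℚ ((↑) : s → NQ N) := hli
  lift s to Finset (NQ N) using hs
  have hray : ∀ x ∈ s, ∃ ρ : F.Ray, (ρ : Cone N) = PointedCone.hull ℚ {x} ∧ (ρ : Cone N) ≤ σ := by
    intro x hx
    have hf := isFaceOf_hull_image (b := id) hli (Finset.singleton_subset_iff.2 hx)
    rw [Set.image_id, Set.image_id, Finset.coe_singleton, hσ] at hf
    exact ⟨⟨⟨_, F.face_mem σ σ.2 _ hf⟩, dim_hull_singleton (hli'.ne_zero ⟨x, hx⟩)⟩, rfl, hf.le⟩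
  constructor
  · refine le_antisymm ?_ (Submodule.span_le.2 ?_)
    · rw [← hσ]
      refine Submodule.span_le.2 fun x hx => ?_
      obtain ⟨ρ, h1, h2⟩ := hray x hx
      have h3 : PointedCone.hull ℚ {gen ρ} ≤ PointedCone.hull ℚ (gen '' (rays σ : Set F.Ray)) :=
        Submodule.span_mono (Set.singleton_subset_iff.2 (Set.mem_image_of_mem _ (mem_rays.2 h2)))
      rw [← coe_ray_eq hF, h1] at h3
      exact h3 (PointedCone.subset_hull rfl)
    · rintro _ ⟨ρ, hρ, rfl⟩
      exact (gen_mem_iff hF).2 (mem_rays.1 hρ)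
  · have hgen : ∀ ρ : (rays σ : Set F.Ray), ∃ y : s, ∃ c : ℚ, 0 < c ∧ gen ρ.1 = c • (y : NQ N) := by
      rintro ⟨ρ, hρ⟩
      have hρσ := mem_rays.1 hρ
      have hface : (ρ : Cone N).IsFaceOf σ := isFaceOf_of_le hρσ
      have hmem := (gen_mem_iff hF).2 hρσ
      rw [← hσ, ← Set.image_id (s : Set (NQ N)), mem_hull_image_finset] at hmem
      obtain ⟨c, hc, hsum⟩ := hmem
      obtain ⟨y, hy, hcy⟩ : ∃ y ∈ s, c y ≠ 0 := by
        by_contra! hcon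
        exact gen_ne_zero hF ρ (by
          rw [hsum]; exact Finset.sum_eq_zero fun y hy => by rw [hcon y hy, zero_smul])
      have hcy : 0 < c y := lt_of_le_of_ne (hc y) hcy.symm
      -- A face contains every generator that enters with positive coefficient into one of its
      -- elements. Thus `y` lies on the ray `ρ`, and `gen ρ` is proportional to `y`.
      have hyρ : y ∈ (ρ : Cone N) := by
        have hsum' : ∑ z : s, c z • (z : NQ N) ∈ (ρ : Cone N) := by
          rw [Finset.sum_coe_sort s (fun z => c z • z)]
          exact (show gen ρ = ∑ z ∈ s, c z • z from hsum) ▸ gen_mem hF ρ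
        exact hface.mem_of_sum_smul_mem (f := fun z : s => (z : NQ N)) (c := fun z => c z)
          (fun z => hσ ▸ PointedCone.subset_hull z.2) (fun z => hc z) hsum' ⟨y, hy⟩ hcy
      rw [coe_ray_eq hF, mem_hull_singleton] at hyρ
      obtain ⟨d, hd, hyd⟩ := hyρ
      have hd0 : d ≠ 0 := by
        rintro rfl
        exact hli'.ne_zero ⟨y, hy⟩ (by simpa using hyd)
      refine ⟨⟨y, hy⟩, d⁻¹, inv_pos.2 (lt_of_le_of_ne hd hd0.symm), ?_⟩
      change gen ρ = d⁻¹ • y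
      rw [hyd, smul_smul, inv_mul_cancel₀ hd0, one_smul]
    choose y c hc hy using hgen
    have hinj : Function.Injective y := by
      intro ρ ρ' h
      have : (ρ.1 : Cone N) = ρ'.1 := by
        rw [coe_ray_eq hF, coe_ray_eq hF, hy, hy, hull_singleton_smul (hc _),
          hull_singleton_smul (hc _), h]
      exact Subtype.ext (Subtype.ext (Subtype.ext this))
    have h1 := (hli'.comp y hinj).units_smul (fun ρ => Units.mk0 (c ρ) (hc ρ).ne')
    rw [LinearIndepOn]
    convert h1 using 1
    exact funext hy

theorem coe_eq_hull (hF : F.IsSimplicial) (σ : F.cones) :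
    (σ : Cone N) = PointedCone.hull ℚ (gen '' (rays σ : Set F.Ray)) :=
  (coe_eq_hull_and_linearIndepOn hF σ).1

theorem linearIndepOn_gen (hF : F.IsSimplicial) (σ : F.cones) :
    LinearIndepOn ℚ (gen (F := F)) (rays σ : Set F.Ray) :=
  (coe_eq_hull_and_linearIndepOn hF σ).2

theorem linSpan_eq (hF : F.IsSimplicial) (σ : F.cones) :
    linSpan (σ : Cone N) = Submodule.span ℚ (gen '' (rays σ : Set F.Ray)) := by
  conv_lhs => rw [coe_eq_hull hF σ]
  exact linSpan_hull _

theorem le_iff_rays_subset (hF : F.IsSimplicial) {σ τ : F.cones} :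
    (σ : Cone N) ≤ τ ↔ rays σ ⊆ rays τ := by
  refine ⟨fun h ρ hρ => mem_rays.2 ((mem_rays.1 hρ).trans h), fun h => ?_⟩
  rw [coe_eq_hull hF σ, coe_eq_hull hF τ]
  exact Submodule.span_mono (Set.image_mono (by exact_mod_cast h))

theorem rays_injective (hF : F.IsSimplicial) : Function.Injective (rays (F := F)) := by
  intro σ τ h
  exact Subtype.ext (le_antisymm ((le_iff_rays_subset hF).2 h.le) ((le_iff_rays_subset hF).2 h.ge))

/-- The hull of the generators in `S` is a face of `σ`. It contains no further ray, because the
coordinate form of such a ray would vanish on the hull. -/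
theorem exists_rays_eq (hF : F.IsSimplicial) (σ : F.cones) {S : Finset F.Ray} (hS : S ⊆ rays σ) :
    ∃ τ : F.cones, rays τ = S := by
  classical
  have hf := isFaceOf_hull_image (linearIndepOn_gen hF σ) hS
  rw [← coe_eq_hull hF σ] at hf
  refine ⟨⟨_, F.face_mem σ σ.2 _ hf⟩, Finset.ext fun ρ => ?_⟩
  rw [mem_rays]
  refine ⟨fun h => ?_, fun h => (gen_mem_iff hF).1
    (PointedCone.subset_hull (Set.mem_image_of_mem _ h))⟩
  have hρσ : ρ ∈ rays σ := mem_rays.2 (h.trans hf.le)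
  by_contra hρ
  obtain ⟨m, hm⟩ := exists_dual_eq_on (linearIndepOn_gen hF σ) (fun j => if j = ρ then 1 else 0)
  obtain ⟨c, -, hc⟩ := mem_hull_image_finset.1 ((gen_mem_iff hF).2 h)
  have := congrArg m hc
  rw [apply_sum_of_eq_ite fun j hj => hm j (hS hj), if_neg hρ, hm ρ hρσ, if_pos rfl] at this
  exact one_ne_zero this

theorem isFacetOf_iff [DecidableEq F.Ray] (hF : F.IsSimplicial) {σ τ : F.cones} :
    IsFacetOf (σ : Cone N) τ ↔ ∃ a ∉ rays σ, rays τ = insert a (rays σ) := by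
  constructor
  · rintro ⟨⟨h1, h2⟩, h3⟩
    have hsub := (le_iff_rays_subset hF).1 h1.le
    have hne : rays σ ≠ rays τ := fun h => h2 (congrArg Subtype.val (rays_injective hF h))
    obtain ⟨a, ha, ha'⟩ := Finset.exists_of_ssubset (hsub.ssubset_of_ne hne)
    refine ⟨a, ha', ?_⟩
    have hins : insert a (rays σ) ⊆ rays τ := Finset.insert_subset ha hsub
    -- If `τ` had still more rays, `γ` would be a proper face of `τ` strictly larger than `σ`,
    -- against maximality.
    obtain ⟨γ, hγ⟩ := exists_rays_eq hF τ hins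
    by_contra hcon
    have hγτ : (γ : Cone N) ≤ τ := (le_iff_rays_subset hF).2 (hγ ▸ hins)
    have hσγ : (σ : Cone N) ≤ γ := (le_iff_rays_subset hF).2 (hγ ▸ Finset.subset_insert _ _)
    have := h3 ⟨isFaceOf_of_le hγτ, fun h => hcon (by
      rw [← hγ, Subtype.ext h])⟩ hσγ
    have := (le_iff_rays_subset hF).1 this
    rw [hγ] at this
    exact ha' (this (Finset.mem_insert_self _ _))
  · rintro ⟨a, ha, h⟩
    have hle : (σ : Cone N) ≤ τ := (le_iff_rays_subset hF).2 (h ▸ Finset.subset_insert _ _)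
    refine ⟨⟨isFaceOf_of_le hle, fun he => ?_⟩, ?_⟩
    · rw [Subtype.ext he] at ha
      exact ha (h ▸ Finset.mem_insert_self _ _)
    · rintro γ ⟨h1, h2⟩ h3
      lift γ to F.cones using F.face_mem τ τ.2 γ h1
      rw [le_iff_rays_subset hF] at h3 ⊢
      have h4 := (le_iff_rays_subset hF).1 h1.le
      have h5 : rays γ ≠ rays τ := fun he => h2 (congrArg Subtype.val (rays_injective hF he))
      rw [h] at h4 h5
      intro ρ hρ
      rcases Finset.mem_insert.1 (h4 hρ) with rfl | h'
      · exact absurd (le_antisymm h4 (Finset.insert_subset hρ h3)) h5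
      · exact h'

/-- The class of a normal vector modulo the span of the facet is a positive multiple of the
generator of the additional ray. -/
theorem isNormalVector_normalVector [DecidableEq F.Ray] (hF : F.IsSimplicial) {σ τ : F.cones}
    {a : F.Ray} (ha : a ∉ rays σ) (h : rays τ = insert a (rays σ)) :
    IsNormalVector (τ : Cone N) σ (normalVector τ σ) ∧
      ∃ c : ℚ, 0 < c ∧ ι (normalVector (τ : Cone N) σ) - c • gen a ∈ linSpan (σ : Cone N) := by
  have := ι_normalVector_hull (fun i => by rw [h, Finset.mem_insert]) ha (linearIndepOn_gen hF τ)
  rwa [← coe_eq_hull hF τ, ← coe_eq_hull hF σ] at this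

end Fan

/-! ### Orthogonal projection in `N_ℚ` -/

namespace InnerProduct

variable {N : Type*} [AddCommGroup N] [Module.Finite ℤ N]

variable {F : Fan N}

theorem proj_mem (B : InnerProduct (MQ N)) (σ : F.cones) (m : MQ N) :
    (B.complements F).proj σ m ∈ perp (σ : Cone N) := by
  rw [Fan.Complements.proj, Submodule.projection_apply]
  exact Submodule.coe_mem _

theorem sub_proj_mem (B : InnerProduct (MQ N)) (σ : F.cones) (m : MQ N) :
    m - (B.complements F).proj σ m ∈ B.form.orthogonal (perp (σ : Cone N)) :=
  Submodule.sub_projection_mem ((B.complements F).isCompl σ) m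

theorem proj_eq_self (B : InnerProduct (MQ N)) {σ : F.cones} {m : MQ N}
    (hm : m ∈ perp (σ : Cone N)) : (B.complements F).proj σ m = m :=
  Submodule.projection_eq_self_iff ((B.complements F).isCompl σ) m |>.2 hm

variable [Module.Free ℤ N]

theorem ω_apply_eq_form (B : InnerProduct (MQ N)) (u v : NQ N) :
    B.ω u v = B.form (B.ω u) (B.ω v) := (B.form_ω _ _).symm

theorem ω_comm (B : InnerProduct (MQ N)) (u v : NQ N) : B.ω u v = B.ω v u := by
  rw [ω_apply_eq_form, ω_apply_eq_form, B.symm]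

theorem ω_self_pos (B : InnerProduct (MQ N)) {u : NQ N} (hu : u ≠ 0) : 0 < B.ω u u := by
  rw [ω_apply_eq_form]
  exact B.pos _ (B.ω.map_ne_zero_iff.2 hu)

/-- The orthogonal projection of `N_ℚ` along the linear span of a cone `σ`, for the inner product
on `N_ℚ` that corresponds to `B`. It is dual to `π_σ`. -/
def offSpan (B : InnerProduct (MQ N)) (σ : F.cones) : NQ N →ₗ[ℚ] NQ N :=
  B.ω.symm.toLinearMap ∘ₗ (B.complements F).proj σ ∘ₗ B.ω.toLinearMap

theorem ω_offSpan (B : InnerProduct (MQ N)) (σ : F.cones) (v : NQ N) :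
    B.ω (B.offSpan σ v) = (B.complements F).proj σ (B.ω v) :=
  B.ω.apply_symm_apply _

/-- Orthogonal projections are self-adjoint: both sides equal the form evaluated at `π_σ m` and `π_σ
(ω v)`. -/
theorem apply_offSpan (B : InnerProduct (MQ N)) (σ : F.cones) (m : MQ N) (v : NQ N) :
    m (B.offSpan σ v) = (B.complements F).proj σ m v := by
  have h1 : B.form ((B.complements F).proj σ (B.ω v)) (m - (B.complements F).proj σ m) = 0 :=
    B.sub_proj_mem σ m _ (B.proj_mem σ _)
  have h2 : B.form ((B.complements F).proj σ m) (B.ω v - (B.complements F).proj σ (B.ω v)) = 0 :=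
    B.sub_proj_mem σ (B.ω v) _ (B.proj_mem σ _)
  rw [map_sub, B.symm, sub_eq_zero] at h1
  rw [map_sub, sub_eq_zero] at h2
  rw [← B.form_ω, ω_offSpan, ← B.form_ω ((B.complements F).proj σ m), h1, h2, B.symm]

theorem ω_offSpan_mem (B : InnerProduct (MQ N)) (σ : F.cones) (v : NQ N) :
    B.ω (B.offSpan σ v) ∈ perp (σ : Cone N) := by
  rw [ω_offSpan]; exact B.proj_mem σ _

theorem offSpan_eq_zero (B : InnerProduct (MQ N)) {σ : F.cones} {v : NQ N}
    (hv : v ∈ linSpan (σ : Cone N)) : B.offSpan σ v = 0 := by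
  rw [← Module.forall_dual_apply_eq_zero_iff ℚ]
  intro m
  rw [apply_offSpan]
  exact perp_apply (B.proj_mem σ m) hv

theorem offSpan_eq_self (B : InnerProduct (MQ N)) {σ : F.cones} {v : NQ N}
    (hv : B.ω v ∈ perp (σ : Cone N)) : B.offSpan σ v = v := by
  apply B.ω.injective
  rw [ω_offSpan, B.proj_eq_self hv]

/-- A subspace is cut out by the forms vanishing on it, and `π_σ` fixes those forms. -/
theorem sub_offSpan_mem (B : InnerProduct (MQ N)) (σ : F.cones) (v : NQ N) :
    v - B.offSpan σ v ∈ linSpan (σ : Cone N) := by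
  rw [← Subspace.dualAnnihilator_dualCoannihilator_eq (W := linSpan (σ : Cone N)),
    Submodule.mem_dualCoannihilator]
  intro m hm
  have hm' : m ∈ perp (σ : Cone N) := fun x hx =>
    (Submodule.mem_dualAnnihilator m).1 hm x (Submodule.subset_span hx)
  rw [map_sub, apply_offSpan, B.proj_eq_self hm', sub_self]

theorem offSpan_eq_of (B : InnerProduct (MQ N)) {σ : F.cones} {v x : NQ N}
    (h1 : v - x ∈ linSpan (σ : Cone N)) (h2 : B.ω x ∈ perp (σ : Cone N)) :
    B.offSpan σ v = x := by
  have := B.offSpan_eq_zero h1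
  rwa [map_sub, B.offSpan_eq_self h2, sub_eq_zero] at this

end InnerProduct

/-! ### Scaling factors between normal vectors and ray generators -/

namespace Fan

variable {N : Type*} [AddCommGroup N] [Module.Finite ℤ N] {F : Fan N}

theorem mem_perp_iff (hF : F.IsSimplicial) {σ : F.cones} {m : MQ N} :
    m ∈ perp (σ : Cone N) ↔ ∀ ρ ∈ rays σ, m (gen ρ) = 0 := by
  refine ⟨fun h ρ hρ => h _ ((gen_mem_iff hF).2 (mem_rays.1 hρ)), fun h x hx => ?_⟩
  have hx' : x ∈ linSpan (σ : Cone N) := Submodule.subset_span hx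
  rw [linSpan_eq hF] at hx'
  have : Submodule.span ℚ (gen '' (rays σ : Set F.Ray)) ≤ LinearMap.ker m := by
    rw [Submodule.span_le]
    rintro _ ⟨ρ, hρ, rfl⟩
    exact h ρ hρ
  exact this hx'

/-- The scaling factor between a normal vector and the generator of the additional ray. -/
theorem exists_scale [DecidableEq F.Ray] (hF : F.IsSimplicial) :
    ∃ scale : F.cones → F.cones → ℚ, ∀ (σ τ : F.cones) (a : F.Ray), a ∉ rays σ →
      rays τ = insert a (rays σ) → 0 < scale σ τ ∧
        ι (normalVector (τ : Cone N) σ) - scale σ τ • gen a ∈ linSpan (σ : Cone N) := by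
  have : ∀ σ τ : F.cones, ∃ c : ℚ, ∀ a : F.Ray, a ∉ rays σ → rays τ = insert a (rays σ) →
      0 < c ∧ ι (normalVector (τ : Cone N) σ) - c • gen a ∈ linSpan (σ : Cone N) := by
    intro σ τ
    by_cases h : ∃ a ∉ rays σ, rays τ = insert a (rays σ)
    · obtain ⟨a, ha, h⟩ := h
      obtain ⟨c, hc⟩ := (isNormalVector_normalVector hF ha h).2
      refine ⟨c, fun a' ha' h' => ?_⟩
      have : a' = a := by
        have : a' ∈ insert a (rays σ) := by rw [← h, h']; exact Finset.mem_insert_self _ _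
        exact (Finset.mem_insert.1 this).resolve_right ha'
      rw [this]; exact hc
    -- The default `0` is used only when `σ` is not a facet of `τ`.
    · exact ⟨0, fun a ha h' => absurd ⟨a, ha, h'⟩ h⟩
  choose c hc using this
  exact ⟨c, hc⟩

/-- In the coordinates `x, y` dual to `gen a, gen b` modulo `σ`, the normal vectors of each path
form a triangular pair whose determinant is, up to sign, the product of the two factors. Hence
`mul_le_mul_of_isNormalVector` applies. -/
theorem scale_mul_scale_le [DecidableEq F.Ray] (hF : F.IsSimplicial) {σ τ τ' γ : F.cones}
    {a b : F.Ray} {c d c' d' : ℚ} (hab : a ≠ b) (ha : a ∉ rays σ) (hb : b ∉ rays σ)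
    (hτ : rays τ = insert a (rays σ)) (hτ' : rays τ' = insert b (rays σ))
    (hγ : rays γ = insert b (insert a (rays σ)))
    (hc0 : 0 < c) (hd0 : 0 < d) (hc0' : 0 < c') (hd0' : 0 < d')
    (hc : ι (normalVector (τ : Cone N) σ) - c • gen a ∈ linSpan (σ : Cone N))
    (hd : ι (normalVector (γ : Cone N) τ) - d • gen b ∈ linSpan (τ : Cone N))
    (hc' : ι (normalVector (τ' : Cone N) σ) - c' • gen b ∈ linSpan (σ : Cone N))
    (hd' : ι (normalVector (γ : Cone N) τ') - d' • gen a ∈ linSpan (τ' : Cone N)) :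
    c * d ≤ c' * d' := by
  obtain ⟨x, hx⟩ := exists_dual_eq_on (linearIndepOn_gen hF γ) (fun j => if j = a then 1 else 0)
  obtain ⟨y, hy⟩ := exists_dual_eq_on (linearIndepOn_gen hF γ) (fun j => if j = b then 1 else 0)
  rw [hγ] at hx hy
  simp only [Finset.coe_insert, Set.mem_insert_iff, forall_eq_or_imp, hab, hab.symm,
    if_true, if_false] at hx hy
  have hxσ : x ∈ perp (σ : Cone N) := (mem_perp_iff hF).2 fun ρ hρ => by
    rw [hx.2.2 ρ hρ, if_neg]; rintro rfl; exact ha hρ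
  have hyσ : y ∈ perp (σ : Cone N) := (mem_perp_iff hF).2 fun ρ hρ => by
    rw [hy.2.2 ρ hρ, if_neg]; rintro rfl; exact hb hρ
  have hyτ : y ∈ perp (τ : Cone N) := (mem_perp_iff hF).2 fun ρ hρ => by
    rw [hτ] at hρ
    rcases Finset.mem_insert.1 hρ with rfl | hρ
    · exact hy.2.1
    · exact (mem_perp_iff hF).1 hyσ ρ hρ
  have hxτ' : x ∈ perp (τ' : Cone N) := (mem_perp_iff hF).2 fun ρ hρ => by
    rw [hτ'] at hρ
    rcases Finset.mem_insert.1 hρ with rfl | hρ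
    · exact hx.1
    · exact (mem_perp_iff hF).1 hxσ ρ hρ
  have ev : ∀ {σ : F.cones} {m : MQ N} {n : N} {k : ℚ} {v : NQ N}, m ∈ perp (σ : Cone N) →
      ι n - k • v ∈ linSpan (σ : Cone N) → m (ι n) = k * m v := by
    intro σ m n k v hm h
    have := perp_apply hm h
    rwa [map_sub, map_smul, smul_eq_mul, sub_eq_zero] at this
  have h1 := ev hxσ hc
  have h2 := ev hyτ hd
  have h3 := ev hyσ hc'
  have h4 := ev hxτ' hd'
  have h5 := ev hxσ hc'
  rw [hx.2.1, mul_one] at h1 h4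
  rw [hy.1, mul_one] at h2 h3
  rw [hx.1, mul_zero] at h5
  have hbτ : b ∉ rays τ := by
    rw [hτ, Finset.mem_insert, not_or]; exact ⟨hab.symm, hb⟩
  have hτγ : rays γ = insert b (rays τ) := by rw [hγ, hτ]
  have hτ'γ : (τ' : Cone N) ≤ γ := (le_iff_rays_subset hF).2 (by
    rw [hτ', hγ]; exact Finset.insert_subset_insert _ (Finset.subset_insert _ _))
  have := mul_le_mul_of_isNormalVector (isNormalVector_normalVector hF ha hτ).1
    (isNormalVector_normalVector hF hbτ hτγ).1
    (mem_latticeSpan_of_le hτ'γ (normalVector_mem (τ' : Cone N) σ))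
    (normalVector_mem (γ : Cone N) τ') hxσ hyτ h5
    (by rw [h1, h2]; positivity) (by rw [h3, h4]; positivity)
  rwa [h1, h2, h3, h4] at this

/-- Both pairs of normal vectors are bases of `N_γ / N_σ`, so their determinants agree up to sign.
Exchanging `a` and `b` turns the inequality into equality. -/
theorem scale_mul_scale_eq [DecidableEq F.Ray] (hF : F.IsSimplicial) {scale : F.cones → F.cones → ℚ}
    (hs : ∀ (σ τ : F.cones) (a : F.Ray), a ∉ rays σ →
      rays τ = insert a (rays σ) → 0 < scale σ τ ∧
        ι (normalVector (τ : Cone N) σ) - scale σ τ • gen a ∈ linSpan (σ : Cone N))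
    {σ τ τ' γ : F.cones} {a b : F.Ray} (hab : a ≠ b) (ha : a ∉ rays σ) (hb : b ∉ rays σ)
    (hτ : rays τ = insert a (rays σ)) (hτ' : rays τ' = insert b (rays σ))
    (hγ : rays γ = insert b (insert a (rays σ))) :
    scale σ τ * scale τ γ = scale σ τ' * scale τ' γ := by
  have hbτ : b ∉ rays τ := by
    rw [hτ, Finset.mem_insert, not_or]; exact ⟨hab.symm, hb⟩
  have haτ' : a ∉ rays τ' := by
    rw [hτ', Finset.mem_insert, not_or]; exact ⟨hab, ha⟩
  have hγ' : rays γ = insert a (insert b (rays σ)) := by rw [hγ, Finset.insert_comm]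
  obtain ⟨h1, h1'⟩ := hs σ τ a ha hτ
  obtain ⟨h2, h2'⟩ := hs τ γ b hbτ (by rw [hγ, hτ])
  obtain ⟨h3, h3'⟩ := hs σ τ' b hb hτ'
  obtain ⟨h4, h4'⟩ := hs τ' γ a haτ' (by rw [hγ', hτ'])
  exact le_antisymm
    (scale_mul_scale_le hF hab ha hb hτ hτ' hγ h1 h2 h3 h4 h1' h2' h3' h4')
    (scale_mul_scale_le hF hab.symm hb ha hτ' hτ hγ' h3 h4 h1 h2 h3' h4' h1' h2')

end Fan

/-! ### Coordinates of divisors and coefficients of their action -/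

namespace Fan

variable {N : Type*} [AddCommGroup N] {F : Fan N}

/-- The values `⟨m_ρ, v_ρ⟩` of the local equations of a divisor at the generators of the rays. -/
def coord : F.QCartier →ₗ[ℚ] F.Ray → ℚ :=
  LinearMap.pi fun ρ => pairing (ρ : Cone N) (primitive (ρ : Cone N)) (normalVector_mem _ _) ∘ₗ
    LinearMap.proj ρ.1 ∘ₗ F.QCartier.subtype

theorem divisorCycle_eq (D : F.QCartier) : divisorCycle D = ∑ ρ : F.Ray, coord D ρ • V ρ.1 := rfl

theorem apply_gen_eq_coord {D : F.QCartier} {σ : F.cones} {m : MQ N}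
    (hm : Submodule.Quotient.mk m = D.1 σ) {ρ : F.Ray} (hρ : ρ ∈ rays σ) :
    m (gen ρ) = coord D ρ := by
  have h := D.2 σ ρ.1 (isFaceOf_of_le (mem_rays.1 hρ))
  rw [← hm] at h
  change _ = pairing (ρ : Cone N) (primitive (ρ : Cone N)) (normalVector_mem _ _) (D.1 ρ.1)
  rw [← h]
  rfl

theorem coord_eq_of_divisorCycle_eq {D E : F.QCartier} (h : divisorCycle D = divisorCycle E) :
    coord D = coord E := by
  classical
  have key : ∀ (D : F.QCartier) (ρ : F.Ray), divisorCycle D ρ.1 = coord D ρ := by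
    intro D ρ
    rw [divisorCycle_eq, Finsupp.finsetSum_apply, Finset.sum_eq_single ρ]
    · simp [V]
    · intro ρ' _ h
      have : ρ'.1 ≠ ρ.1 := fun he => h (Subtype.ext he)
      simp [V, this]
    · simp
  funext ρ
  rw [← key, ← key, h]

namespace Complements

variable (P : F.Complements)

open scoped Classical in
/-- The coefficient of `[V(τ)]` in `D · [V(σ)]`. -/
def coeff (σ τ : F.cones) : F.QCartier →ₗ[ℚ] ℚ :=
  if h : IsFacetOf (σ : Cone N) (τ : Cone N) then
    pairing (τ : Cone N) (normalVector τ σ) (normalVector_mem _ _) ∘ₗ P.projQuot σ τ h.prop.1.le ∘ₗ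
      LinearMap.proj τ ∘ₗ F.QCartier.subtype
  else 0

theorem coeff_of_not_isFacetOf {σ τ : F.cones} (h : ¬ IsFacetOf (σ : Cone N) (τ : Cone N)) :
    P.coeff σ τ = 0 := by rw [coeff, dif_neg h]

theorem coeff_apply {σ τ : F.cones} (h : IsFacetOf (σ : Cone N) (τ : Cone N)) {D : F.QCartier}
    {m : MQ N} (hm : Submodule.Quotient.mk m = D.1 τ) :
    P.coeff σ τ D = P.proj σ m (ι (normalVector (τ : Cone N) σ)) := by
  rw [coeff, dif_pos h]
  change pairing (τ : Cone N) (normalVector τ σ) (normalVector_mem _ _)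
    (P.projQuot σ τ h.prop.1.le (D.1 τ)) = _
  rw [← hm]
  rfl

theorem actOn_eq (D : F.QCartier) (σ : F.cones) :
    P.actOn D σ = ∑ τ, P.coeff σ τ D • V τ := by
  rw [actOn]
  refine Finset.sum_congr rfl fun τ _ => ?_
  by_cases h : IsFacetOf (σ : Cone N) (τ : Cone N)
  · rw [dif_pos h, coeff, dif_pos h]
    rfl
  · rw [dif_neg h, coeff, dif_neg h, LinearMap.zero_apply, zero_smul]

theorem act_V (D : F.QCartier) (σ : F.cones) :
    P.act D (V σ) = ∑ τ, P.coeff σ τ D • V τ := by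
  rw [act, V, Finsupp.linearCombination_single, one_smul, actOn_eq]

/-- The action of divisors on cycles as a linear map. -/
def actHom : F.QCartier →ₗ[ℚ] Module.End ℚ F.Cycles where
  toFun := P.act
  map_add' := fun D E => by
    refine Finsupp.lhom_ext' fun σ => LinearMap.ext_ring ?_
    change P.act (D + E) (V σ) = P.act D (V σ) + P.act E (V σ)
    simp only [act_V, map_add, add_smul, Finset.sum_add_distrib]
  map_smul' := fun c D => by
    refine Finsupp.lhom_ext' fun σ => LinearMap.ext_ring ?_
    change P.act (c • D) (V σ) = c • P.act D (V σ)
    simp only [act_V, map_smul, smul_eq_mul, mul_smul, Finset.smul_sum]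

theorem actHom_apply (D : F.QCartier) : P.actHom D = P.act D := rfl

end Complements

variable [Module.Finite ℤ N]

theorem coord_injective (hF : F.IsSimplicial) : Function.Injective (coord (F := F)) := by
  intro D E h
  refine Subtype.ext (funext fun σ => ?_)
  obtain ⟨m, hm⟩ := Submodule.Quotient.mk_surjective _ (D.1 σ)
  obtain ⟨m', hm'⟩ := Submodule.Quotient.mk_surjective _ (E.1 σ)
  rw [← hm, ← hm', Submodule.Quotient.eq, mem_perp_iff hF]
  intro ρ hρ
  rw [LinearMap.sub_apply, apply_gen_eq_coord hm hρ, apply_gen_eq_coord hm' hρ, h, sub_self]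

/-- On each cone independence gives a form with the prescribed values at the generators. Two choices
differ by an element vanishing on the common face, so the classes are compatible. -/
theorem coord_surjective (hF : F.IsSimplicial) : Function.Surjective (coord (F := F)) := by
  intro c
  choose m hm using fun σ => exists_dual_eq_on (linearIndepOn_gen hF σ) c
  have hm' : ∀ σ, ∀ ρ ∈ rays σ, m σ (gen ρ) = c ρ := hm
  refine ⟨⟨fun σ => Submodule.Quotient.mk (m σ), fun σ τ h => ?_⟩, funext fun ρ => ?_⟩
  · change Submodule.Quotient.mk (m σ) = Submodule.Quotient.mk (m τ)
    rw [Submodule.Quotient.eq, mem_perp_iff hF]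
    intro ρ hρ
    rw [LinearMap.sub_apply, hm' τ ρ hρ, hm' σ ρ ((le_iff_rays_subset hF).1 h.le hρ), sub_self]
  · exact hm' ρ.1 ρ (mem_rays.2 le_rfl)

/-- On a simplicial fan, a divisor is determined by its arbitrary values at the generators. -/
def coordEquiv (hF : F.IsSimplicial) : F.QCartier ≃ₗ[ℚ] (F.Ray → ℚ) :=
  LinearEquiv.ofBijective coord ⟨coord_injective hF, coord_surjective hF⟩

open scoped Classical in
/-- The divisor with cycle `[V(ρ)]`. -/
def rayDivisor (hF : F.IsSimplicial) (ρ : F.Ray) : F.QCartier :=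
  (coordEquiv hF).symm (Pi.single ρ 1)

theorem coord_rayDivisor [DecidableEq F.Ray] (hF : F.IsSimplicial) (ρ : F.Ray) :
    coord (rayDivisor hF ρ) = Pi.single ρ 1 := by
  have h : coord (rayDivisor hF ρ) = _ := (coordEquiv hF).apply_symm_apply _
  convert h

theorem eq_sum_rayDivisor (hF : F.IsSimplicial) (D : F.QCartier) :
    D = ∑ ρ, coord D ρ • rayDivisor hF ρ := by
  classical
  apply coord_injective hF
  rw [map_sum]
  simp only [map_smul, coord_rayDivisor]
  exact pi_eq_sum_univ' _

theorem divisorCycle_rayDivisor (hF : F.IsSimplicial) (ρ : F.Ray) :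
    divisorCycle (rayDivisor hF ρ) = V ρ.1 := by
  classical
  rw [divisorCycle_eq, coord_rayDivisor, Finset.sum_eq_single ρ]
  · rw [Pi.single_eq_same, one_smul]
  · intro ρ' _ h
    rw [Pi.single_eq_of_ne h, zero_smul]
  · simp

theorem existsUnique_divisorCycle_eq (hF : F.IsSimplicial) (ρ : F.Ray) :
    ∃! D : F.QCartier, divisorCycle D = V ρ.1 :=
  ⟨rayDivisor hF ρ, divisorCycle_rayDivisor hF ρ, fun _ hD => coord_injective hF
    (coord_eq_of_divisorCycle_eq (hD.trans (divisorCycle_rayDivisor hF ρ).symm))⟩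

end Fan

/-! ### Commutativity of the action -/

namespace InnerProduct

open Fan

variable {N : Type*} [AddCommGroup N] [Module.Finite ℤ N] {F : Fan N}
  [DecidableEq F.Ray]

/-- The diamond property: a cone between `σ` and `γ` adds exactly one of the rays `a`, `b` to `σ`.
-/
theorem sum_coeff_mul_coeff (hF : F.IsSimplicial) (B : InnerProduct (MQ N)) (D E : F.QCartier)
    {σ τ τ' γ : F.cones} {a b : F.Ray} (hab : a ≠ b) (ha : a ∉ rays σ) (hb : b ∉ rays σ)
    (hτ : rays τ = insert a (rays σ)) (hτ' : rays τ' = insert b (rays σ))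
    (hγ : rays γ = insert b (insert a (rays σ))) :
    ∑ δ, (B.complements F).coeff σ δ D * (B.complements F).coeff δ γ E =
      (B.complements F).coeff σ τ D * (B.complements F).coeff τ γ E +
        (B.complements F).coeff σ τ' D * (B.complements F).coeff τ' γ E := by
  classical
  have hne : τ ≠ τ' := by
    rintro rfl
    have : a ∈ insert b (rays σ) := by rw [← hτ', hτ]; exact Finset.mem_insert_self _ _
    exact (Finset.mem_insert.1 this).elim hab ha
  rw [← Finset.sum_pair (f := fun δ =>
    (B.complements F).coeff σ δ D * (B.complements F).coeff δ γ E) hne]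
  symm
  refine Finset.sum_subset (Finset.subset_univ _) fun δ _ hδ => ?_
  by_contra hcon
  have h1 : IsFacetOf (σ : Cone N) δ := by
    by_contra h
    exact hcon (by rw [Complements.coeff_of_not_isFacetOf _ h]; simp)
  have h2 : IsFacetOf (δ : Cone N) γ := by
    by_contra h
    exact hcon (by rw [Complements.coeff_of_not_isFacetOf _ h]; simp)
  obtain ⟨x, hx, hx'⟩ := (isFacetOf_iff hF).1 h1
  obtain ⟨y, hy, hy'⟩ := (isFacetOf_iff hF).1 h2
  have hxγ : x ∈ insert b (insert a (rays σ)) := by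
    rw [← hγ, hy', hx']; simp
  rw [Finset.mem_insert, Finset.mem_insert] at hxγ
  apply hδ
  rw [Finset.mem_insert, Finset.mem_singleton]
  rcases hxγ with rfl | rfl | h
  · exact Or.inr (rays_injective hF (hx'.trans hτ'.symm))
  · exact Or.inl (rays_injective hF (hx'.trans hτ.symm))
  · exact absurd h hx

variable [Module.Free ℤ N]

/-- The projection moves from `m` to the normal vector, where it kills the part in the span of `σ`
and leaves a multiple of the projected generator. Any `m` with the right values on the rays of `τ`
is a local equation there. -/
theorem coeff_eq (hF : F.IsSimplicial) (B : InnerProduct (MQ N)) {σ τ : F.cones} {a : F.Ray}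
    (ha : a ∉ rays σ) (hτ : rays τ = insert a (rays σ)) {c : ℚ}
    (hc : ι (normalVector (τ : Cone N) σ) - c • gen a ∈ linSpan (σ : Cone N)) {D : F.QCartier}
    {m : MQ N} (hm : ∀ ρ ∈ rays τ, m (gen ρ) = coord D ρ) :
    (B.complements F).coeff σ τ D = c * m (B.offSpan σ (gen a)) := by
  have hm' : Submodule.Quotient.mk m = D.1 τ := by
    obtain ⟨m', hm'⟩ := Submodule.Quotient.mk_surjective _ (D.1 τ)
    rw [← hm', Submodule.Quotient.eq, mem_perp_iff hF]
    intro ρ hρ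
    rw [LinearMap.sub_apply, hm ρ hρ, apply_gen_eq_coord hm' hρ, sub_self]
  have h0 := B.offSpan_eq_zero hc
  rw [map_sub, map_smul, sub_eq_zero] at h0
  rw [Complements.coeff_apply _ ((isFacetOf_iff hF).2 ⟨a, ha, hτ⟩) hm', ← apply_offSpan, h0,
    map_smul, smul_eq_mul]

theorem offSpan_gen_ne_zero (hF : F.IsSimplicial) (B : InnerProduct (MQ N)) {σ τ : F.cones}
    {a : F.Ray} (ha : a ∉ rays σ) (hτ : rays τ = insert a (rays σ)) :
    B.offSpan σ (gen a) ≠ 0 := by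
  intro h0
  have h := B.sub_offSpan_mem σ (gen a)
  rw [h0, sub_zero] at h
  obtain ⟨m, hm⟩ := exists_dual_eq_on (linearIndepOn_gen hF τ) (fun j => if j = a then 1 else 0)
  rw [hτ] at hm
  have hmσ : m ∈ perp (σ : Cone N) := (mem_perp_iff hF).2 fun ρ hρ => by
    rw [hm ρ (Finset.mem_coe.2 (Finset.mem_insert_of_mem hρ)), if_neg]
    rintro rfl
    exact ha hρ
  have h1 := hm a (Finset.mem_coe.2 (Finset.mem_insert_self _ _))
  rw [perp_apply hmσ h, if_pos rfl] at h1
  exact zero_ne_one h1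

/-- One step of the Gram–Schmidt process. -/
theorem offSpan_insert (hF : F.IsSimplicial) (B : InnerProduct (MQ N)) {σ τ : F.cones}
    {a : F.Ray} (ha : a ∉ rays σ) (hτ : rays τ = insert a (rays σ)) (v : NQ N) :
    B.offSpan τ v = B.offSpan σ v -
      (B.ω (B.offSpan σ (gen a)) (B.offSpan σ v) /
        B.ω (B.offSpan σ (gen a)) (B.offSpan σ (gen a))) • B.offSpan σ (gen a) := by
  set u := B.offSpan σ (gen a) with hu
  set w := B.offSpan σ v with hw
  have hστ : (σ : Cone N) ≤ τ := (le_iff_rays_subset hF).2 (hτ ▸ Finset.subset_insert _ _)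
  have hle : linSpan (σ : Cone N) ≤ linSpan (τ : Cone N) := Submodule.span_mono hστ
  have hgen : gen a ∈ linSpan (τ : Cone N) := Submodule.subset_span
    ((gen_mem_iff hF).2 (mem_rays.1 (hτ ▸ Finset.mem_insert_self _ _)))
  have huτ : u ∈ linSpan (τ : Cone N) := by
    have := sub_mem hgen (hle (B.sub_offSpan_mem σ (gen a)))
    rwa [sub_sub_cancel] at this
  have huu : B.ω u u ≠ 0 := (B.ω_self_pos (B.offSpan_gen_ne_zero hF ha hτ)).ne'
  have huσ : B.ω u ∈ perp (σ : Cone N) := B.ω_offSpan_mem σ _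
  have hwσ : B.ω w ∈ perp (σ : Cone N) := B.ω_offSpan_mem σ _
  apply B.offSpan_eq_of
  · rw [← sub_add]
    exact add_mem (hle (B.sub_offSpan_mem σ v)) (Submodule.smul_mem _ _ huτ)
  -- On the new ray it suffices to test against `u`, which differs from its generator by an element
  -- of the span of `σ`.
  · have hxσ : B.ω (w - (B.ω u w / B.ω u u) • u) ∈ perp (σ : Cone N) := by
      rw [map_sub, map_smul]
      exact sub_mem hwσ (Submodule.smul_mem _ _ huσ)
    rw [mem_perp_iff hF]
    intro ρ hρ
    rw [hτ] at hρ
    rcases Finset.mem_insert.1 hρ with rfl | hρ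
    · have h1 : B.ω (w - (B.ω u w / B.ω u u) • u) (gen ρ) =
          B.ω (w - (B.ω u w / B.ω u u) • u) u := by
        rw [← sub_eq_zero, ← map_sub]
        exact perp_apply hxσ (B.sub_offSpan_mem σ (gen ρ))
      rw [h1, map_sub, map_smul, LinearMap.sub_apply, LinearMap.smul_apply, smul_eq_mul,
        div_mul_cancel₀ _ huu, B.ω_comm w u, sub_self]
    · exact (mem_perp_iff hF).1 hxσ ρ hρ

/-- With `u`, `w` the projections of the two new generators, each path contributes the same lattice
factor times `d u * e w` or `d w * e u`, corrected by a Gram–Schmidt term that is symmetric in `d`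
and `e`. The sum over both paths is therefore symmetric. -/
theorem sum_coeff_mul_coeff_comm (hF : F.IsSimplicial) (B : InnerProduct (MQ N))
    (D E : F.QCartier) (σ γ : F.cones) :
    ∑ δ, (B.complements F).coeff σ δ D * (B.complements F).coeff δ γ E =
      ∑ δ, (B.complements F).coeff σ δ E * (B.complements F).coeff δ γ D := by
  by_cases hσγ : ∃ δ : F.cones, IsFacetOf (σ : Cone N) δ ∧ IsFacetOf (δ : Cone N) γ
  · obtain ⟨τ, h1, h2⟩ := hσγ
    obtain ⟨a, ha, hτ⟩ := (isFacetOf_iff hF).1 h1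
    obtain ⟨b, hb, hγ⟩ := (isFacetOf_iff hF).1 h2
    have hab : a ≠ b := by
      rintro rfl
      exact hb (hτ ▸ Finset.mem_insert_self _ _)
    have hbσ : b ∉ rays σ := fun h => hb (hτ ▸ Finset.mem_insert_of_mem h)
    have hγ' : rays γ = insert b (insert a (rays σ)) := by rw [hγ, hτ]
    obtain ⟨τ', hτ'⟩ := exists_rays_eq hF γ (S := insert b (rays σ)) (by
      rw [hγ']; exact Finset.insert_subset_insert _ (Finset.subset_insert _ _))
    have haτ' : a ∉ rays τ' := by
      rw [hτ', Finset.mem_insert, not_or]; exact ⟨hab, ha⟩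
    have hγτ' : rays γ = insert a (rays τ') := by rw [hγ', hτ', Finset.insert_comm]
    rw [B.sum_coeff_mul_coeff hF D E hab ha hbσ hτ hτ' hγ',
      B.sum_coeff_mul_coeff hF E D hab ha hbσ hτ hτ' hγ']
    obtain ⟨scale, hs⟩ := exists_scale hF
    have hsq := scale_mul_scale_eq hF hs hab ha hbσ hτ hτ' hγ'
    obtain ⟨d, hd⟩ := Submodule.Quotient.mk_surjective _ (D.1 γ)
    obtain ⟨e, he⟩ := Submodule.Quotient.mk_surjective _ (E.1 γ)
    have hdγ : ∀ ρ ∈ rays γ, d (gen ρ) = coord D ρ := fun ρ hρ => apply_gen_eq_coord hd hρ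
    have heγ : ∀ ρ ∈ rays γ, e (gen ρ) = coord E ρ := fun ρ hρ => apply_gen_eq_coord he hρ
    have hτγ : rays τ ⊆ rays γ := hγ ▸ Finset.subset_insert _ _
    have hτγ' : rays τ' ⊆ rays γ := hγτ' ▸ Finset.subset_insert _ _
    have hu : 0 < B.ω (B.offSpan σ (gen a)) (B.offSpan σ (gen a)) :=
      B.ω_self_pos (B.offSpan_gen_ne_zero hF ha hτ)
    have hw : 0 < B.ω (B.offSpan σ (gen b)) (B.offSpan σ (gen b)) :=
      B.ω_self_pos (B.offSpan_gen_ne_zero hF hbσ hτ')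
    rw [B.coeff_eq hF ha hτ (hs _ _ _ ha hτ).2 fun ρ hρ => hdγ ρ (hτγ hρ),
      B.coeff_eq hF ha hτ (hs _ _ _ ha hτ).2 fun ρ hρ => heγ ρ (hτγ hρ),
      B.coeff_eq hF hbσ hτ' (hs _ _ _ hbσ hτ').2 fun ρ hρ => hdγ ρ (hτγ' hρ),
      B.coeff_eq hF hbσ hτ' (hs _ _ _ hbσ hτ').2 fun ρ hρ => heγ ρ (hτγ' hρ),
      B.coeff_eq hF hb hγ (hs _ _ _ hb hγ).2 hdγ, B.coeff_eq hF hb hγ (hs _ _ _ hb hγ).2 heγ,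
      B.coeff_eq hF haτ' hγτ' (hs _ _ _ haτ' hγτ').2 hdγ,
      B.coeff_eq hF haτ' hγτ' (hs _ _ _ haτ' hγτ').2 heγ,
      B.offSpan_insert hF ha hτ, B.offSpan_insert hF hbσ hτ',
      B.ω_comm (B.offSpan σ (gen b)) (B.offSpan σ (gen a))]
    generalize B.offSpan σ (gen a) = u at *
    generalize B.offSpan σ (gen b) = w at *
    simp only [map_sub, map_smul, smul_eq_mul]
    -- The coefficient is the antisymmetrization in `d, e` of the contribution of the path through
    -- `τ`; that of the other path is its negative.
    linear_combination
      (d u * (e w - B.ω u w / B.ω u u * e u) - e u * (d w - B.ω u w / B.ω u u * d u)) * hsq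
  · push Not at hσγ
    have hz : ∀ (D E : F.QCartier) (δ : F.cones),
        (B.complements F).coeff σ δ D * (B.complements F).coeff δ γ E = 0 := by
      intro D E δ
      by_cases h : IsFacetOf (σ : Cone N) δ
      · rw [Complements.coeff_of_not_isFacetOf _ (hσγ δ h), LinearMap.zero_apply, mul_zero]
      · rw [Complements.coeff_of_not_isFacetOf _ h, LinearMap.zero_apply, zero_mul]
    rw [Finset.sum_eq_zero fun δ _ => hz D E δ, Finset.sum_eq_zero fun δ _ => hz E D δ]

theorem act_comm (hF : F.IsSimplicial) (B : InnerProduct (MQ N)) (D E : F.QCartier) :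
    (B.complements F).actHom D * (B.complements F).actHom E =
      (B.complements F).actHom E * (B.complements F).actHom D := by
  have key : ∀ (D E : F.QCartier) (σ : F.cones),
      (B.complements F).act D ((B.complements F).act E (V σ)) =
        ∑ γ, (∑ δ, (B.complements F).coeff σ δ E * (B.complements F).coeff δ γ D) • V γ := by
    intro D E σ
    rw [Complements.act_V, map_sum]
    simp only [map_smul, Complements.act_V, Finset.smul_sum, Finset.sum_smul, smul_smul]
    rw [Finset.sum_comm]
  refine Finsupp.lhom_ext' fun σ => LinearMap.ext_ring ?_
  change (B.complements F).act D ((B.complements F).act E (V σ)) =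
    (B.complements F).act E ((B.complements F).act D (V σ))
  rw [key, key]
  exact Finset.sum_congr rfl fun γ _ => by rw [B.sum_coeff_mul_coeff_comm hF]

end InnerProduct

/-! ### Polynomial rings acting on the faces of a complex -/

section CommutingOperators

open MvPolynomial

-- The subalgebra generated by commuting operators is commutative, so polynomials can be evaluated
-- in it.
open scoped IsMulCommutative in
theorem exists_algHom_of_commute {R M : Type*} [AddCommGroup M] [Module ℚ M]
    (T : R → Module.End ℚ M) (hT : ∀ i j, T i * T j = T j * T i) :
    ∃ φ : MvPolynomial R ℚ →ₐ[ℚ] Module.End ℚ M, ∀ i, φ (X i) = T i := by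
  have hcomm : ∀ a ∈ Set.range T, ∀ b ∈ Set.range T, a * b = b * a := by
    rintro _ ⟨i, rfl⟩ _ ⟨j, rfl⟩
    exact hT i j
  have := Algebra.isMulCommutative_adjoin ℚ hcomm
  let ev : MvPolynomial R ℚ →ₐ[ℚ] Algebra.adjoin ℚ (Set.range T) :=
    aeval (R := ℚ) fun i => (⟨T i, Algebra.subset_adjoin ⟨i, rfl⟩⟩ : Algebra.adjoin ℚ (Set.range T))
  refine ⟨(Algebra.adjoin ℚ (Set.range T)).val.comp ev, fun i => ?_⟩
  rw [AlgHom.comp_apply, aeval_X]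
  rfl

variable {R Δ : Type*} [Fintype R] [DecidableEq R] {s : Δ → Finset R} {o : Δ} {g : R → R → ℚ}
  {T : R → Module.End ℚ (Δ →₀ ℚ)} {φ : MvPolynomial R ℚ →ₐ[ℚ] Module.End ℚ (Δ →₀ ℚ)}

/-- Operators `T i` on the space with basis the faces `c` of a simplicial complex with vertex set
`R` (the vertices of `c` being `s c`) which multiply a face by a vertex up to scaling, and which
satisfy linear relations with coefficients `g`. -/
structure IsFaceAction (s : Δ → Finset R) (o : Δ) (g : R → R → ℚ)
    (T : R → Module.End ℚ (Δ →₀ ℚ)) : Prop where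
  injective : Function.Injective s
  down : ∀ c (S : Finset R), S ⊆ s c → ∃ c', s c' = S
  empty : s o = ∅
  step : ∀ c c' i, i ∉ s c → s c' = insert i (s c) →
    ∃ l : ℚ, l ≠ 0 ∧ T i (Finsupp.single c 1) = l • Finsupp.single c' 1
  step_zero : ∀ c i, i ∉ s c → (¬ ∃ c', s c' = insert i (s c)) → T i (Finsupp.single c 1) = 0
  linear : ∀ c, ∀ i ∈ s c, ∑ j, g i j • T j (Finsupp.single c 1) = 0
  nondegenerate : ∀ c, ∀ i ∈ s c, ∃ a : R → ℚ, (∀ k, k ∉ s c → a k = 0) ∧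
    ∀ j ∈ s c, ∑ k, a k * g k j = if j = i then 1 else 0

/-- The ideal generated by the monomials of the non-faces. -/
def nonFaceIdeal (s : Δ → Finset R) : Ideal (MvPolynomial R ℚ) :=
  Ideal.span {p | ∃ S : Finset R, (¬ ∃ c, s c = S) ∧ p = ∏ i ∈ S, X i}

/-- The ideal generated by the quadrics `∑_j g_ij Y_i Y_j`. -/
def quadricIdeal (g : R → R → ℚ) : Ideal (MvPolynomial R ℚ) :=
  Ideal.span (Set.range fun i : R => ∑ j, C (g i j) * (X i * X j))

namespace IsFaceAction

theorem prod_apply_face (h : IsFaceAction s o g T) (hφ : ∀ i, φ (X i) = T i) (S : Finset R) :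
    ∀ c, s c = S →
      ∃ l : ℚ, l ≠ 0 ∧ φ (∏ i ∈ S, X i) (Finsupp.single o 1) = l • Finsupp.single c 1 := by
  induction S using Finset.induction_on with
  | empty =>
    intro c hc
    rw [h.injective (hc.trans h.empty.symm)]
    exact ⟨1, one_ne_zero, by simp⟩
  | insert i S hi ih =>
    intro c hc
    obtain ⟨c', hc'⟩ := h.down c S (hc ▸ Finset.subset_insert _ _)
    obtain ⟨l, hl, hl'⟩ := ih c' hc'
    obtain ⟨k, hk, hk'⟩ := h.step c' c i (hc' ▸ hi) (hc' ▸ hc)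
    refine ⟨l * k, mul_ne_zero hl hk, ?_⟩
    rw [Finset.prod_insert hi, map_mul, Module.End.mul_apply, hl', map_smul, hφ, hk', smul_smul]

theorem prod_apply_nonFace (h : IsFaceAction s o g T) (hφ : ∀ i, φ (X i) = T i) (S : Finset R) :
    (¬ ∃ c, s c = S) → φ (∏ i ∈ S, X i) (Finsupp.single o 1) = 0 := by
  induction S using Finset.induction_on with
  | empty => exact fun hS => absurd ⟨o, h.empty⟩ hS
  | insert i S hi ih =>
    intro hS
    rw [Finset.prod_insert hi, map_mul, Module.End.mul_apply]
    by_cases hS' : ∃ c, s c = S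
    · obtain ⟨c, rfl⟩ := hS'
      obtain ⟨l, hl, hl'⟩ := h.prod_apply_face hφ _ c rfl
      rw [hl', map_smul, hφ, h.step_zero c i hi hS, smul_zero]
    · rw [ih hS', map_zero]

theorem apply_surjective (h : IsFaceAction s o g T) (hφ : ∀ i, φ (X i) = T i) :
    Function.Surjective fun p => φ p (Finsupp.single o 1) := by
  have hr : LinearMap.range
      ((LinearMap.applyₗ (Finsupp.single o 1) : Module.End ℚ (Δ →₀ ℚ) →ₗ[ℚ] (Δ →₀ ℚ)) ∘ₗ
        φ.toLinearMap) = ⊤ := by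
    rw [eq_top_iff, ← (Finsupp.basisSingleOne (R := ℚ) (ι := Δ)).span_eq, Submodule.span_le]
    rintro _ ⟨c, rfl⟩
    obtain ⟨l, hl, hl'⟩ := h.prod_apply_face hφ _ c rfl
    refine ⟨l⁻¹ • ∏ i ∈ s c, X i, ?_⟩
    rw [map_smul, LinearMap.comp_apply, AlgHom.toLinearMap_apply, LinearMap.applyₗ_apply_apply, hl',
      smul_smul, inv_mul_cancel₀ hl, one_smul, Finsupp.coe_basisSingleOne]
  exact LinearMap.range_eq_top.1 hr

theorem apply_eq_zero_of_mem (h : IsFaceAction s o g T) (hφ : ∀ i, φ (X i) = T i)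
    {p : MvPolynomial R ℚ} (hp : p ∈ nonFaceIdeal s ⊔ quadricIdeal g) :
    φ p (Finsupp.single o 1) = 0 := by
  let K : Ideal (MvPolynomial R ℚ) :=
    { carrier := {p | φ p (Finsupp.single o 1) = 0}
      zero_mem' := by simp
      add_mem' := fun {a b} (ha : _ = _) (hb : _ = _) => by
        simp [ha, hb]
      smul_mem' := fun a b (hb : _ = _) => by
        simp [hb] }
  suffices nonFaceIdeal s ⊔ quadricIdeal g ≤ K from this hp
  refine sup_le (Ideal.span_le.2 ?_) (Ideal.span_le.2 ?_)
  · rintro _ ⟨S, hS, rfl⟩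
    exact h.prod_apply_nonFace hφ S hS
  · rintro _ ⟨i, rfl⟩
    change φ (∑ j, C (g i j) * (X i * X j)) (Finsupp.single o 1) = 0
    -- The factors are exchanged so that `T i` acts first: it moves the empty face to the face
    -- `{i}`, where the linear relation for `i` applies.
    have : ∑ j, C (g i j) * (X i * X j) = ∑ j, g i j • (X j * X i : MvPolynomial R ℚ) :=
      Finset.sum_congr rfl fun j _ => by rw [smul_eq_C_mul, mul_comm (X i)]
    rw [this, map_sum, LinearMap.sum_apply]
    simp only [map_smul, map_mul, LinearMap.smul_apply, Module.End.mul_apply, hφ]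
    have hio : i ∉ s o := by simp [h.empty]
    by_cases hc : ∃ c, s c = insert i (s o)
    · obtain ⟨c, hc⟩ := hc
      obtain ⟨l, -, hl⟩ := h.step o c i hio hc
      simp only [hl, map_smul]
      simp only [smul_comm _ l]
      rw [← Finset.smul_sum, h.linear c i (hc ▸ Finset.mem_insert_self _ _), smul_zero]
    · simp [h.step_zero o i hio hc]

/-- The left side contains `1` and is stable under every variable. Multiplying a face monomial by a
new variable gives a face monomial or a generator of the non-face ideal. For a repeated variable,
the quadrics indexed by the face are combined using the inverse of its Gram matrix, which trades
that variable for new ones. -/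
theorem span_sup_eq_top (h : IsFaceAction s o g T) :
    Submodule.span ℚ (Set.range fun c => (∏ i ∈ s c, X i : MvPolynomial R ℚ)) ⊔
      (nonFaceIdeal s ⊔ quadricIdeal g).restrictScalars ℚ = ⊤ := by
  set W := Submodule.span ℚ (Set.range fun c => (∏ i ∈ s c, X i : MvPolynomial R ℚ)) ⊔
      (nonFaceIdeal s ⊔ quadricIdeal g).restrictScalars ℚ with hW
  have hface : ∀ c, (∏ i ∈ s c, X i : MvPolynomial R ℚ) ∈ W := fun c =>
    Submodule.mem_sup_left (Submodule.subset_span ⟨c, rfl⟩)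
  have hideal : ∀ p ∈ nonFaceIdeal s ⊔ quadricIdeal g, p ∈ W := fun p hp =>
    Submodule.mem_sup_right hp
  have hnotMem : ∀ c, ∀ i, i ∉ s c → X i * ∏ i ∈ s c, X i ∈ W := by
    intro c i hi
    rw [← Finset.prod_insert hi]
    by_cases hc : ∃ c', s c' = insert i (s c)
    · obtain ⟨c', hc'⟩ := hc
      rw [← hc']
      exact hface c'
    · exact hideal _ (Ideal.mem_sup_left (Ideal.subset_span ⟨_, hc, rfl⟩))
  have hmem : ∀ c, ∀ i ∈ s c, X i * ∏ i ∈ s c, X i ∈ W := by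
    intro c i hi
    obtain ⟨a, ha, hag⟩ := h.nondegenerate c i hi
    have h1 : ∑ k, a k • ((∑ j, C (g k j) * X j) * ∏ i ∈ s c, X i : MvPolynomial R ℚ) ∈ W := by
      refine Submodule.sum_mem _ fun k _ => ?_
      by_cases hk : k ∈ s c
      · refine W.smul_mem _ (hideal _ (Ideal.mem_sup_right ?_))
        -- Since `k` is a vertex of `c`, the face monomial supplies the factor `X k` that turns the
        -- linear form into a quadric.
        have : ((∑ j, C (g k j) * X j) * ∏ i ∈ s c, X i : MvPolynomial R ℚ) =
            (∏ i ∈ (s c).erase k, X i) * ∑ j, C (g k j) * (X k * X j) := by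
          rw [← Finset.mul_prod_erase _ _ hk, Finset.mul_sum, Finset.sum_mul]
          exact Finset.sum_congr rfl fun j _ => by ring
        rw [this]
        exact Ideal.mul_mem_left _ _ (Ideal.subset_span ⟨k, rfl⟩)
      · rw [ha k hk, zero_smul]
        exact zero_mem _
    have h2 : ∑ k, a k • ((∑ j, C (g k j) * X j) * ∏ i ∈ s c, X i : MvPolynomial R ℚ) =
        ∑ j, (∑ k, a k * g k j) • (X j * ∏ i ∈ s c, X i) := by
      simp only [Finset.sum_mul, Finset.smul_sum, Finset.sum_smul]
      rw [Finset.sum_comm]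
      refine Finset.sum_congr rfl fun j _ => Finset.sum_congr rfl fun k _ => ?_
      rw [smul_eq_C_mul, smul_eq_C_mul, C_mul]
      ring
    rw [h2, ← Finset.sum_filter_add_sum_filter_not Finset.univ (· ∈ s c)] at h1
    have h3 : ∑ j with j ∈ s c, (∑ k, a k * g k j) • (X j * ∏ i ∈ s c, X i) =
        (X i * ∏ i ∈ s c, X i : MvPolynomial R ℚ) := by
      rw [Finset.sum_eq_single i]
      · rw [hag i hi, if_pos rfl, one_smul]
      · intro j hj hji
        rw [hag j (Finset.mem_filter.1 hj).2, if_neg hji, zero_smul]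
      · intro hi'
        exact absurd (Finset.mem_filter.2 ⟨Finset.mem_univ _, hi⟩) hi'
    rw [h3] at h1
    refine (Submodule.add_mem_iff_left W (Submodule.sum_mem _ fun j hj => ?_)).1 h1
    exact W.smul_mem _ (hnotMem c j (Finset.mem_filter.1 hj).2)
  have hX : ∀ i, W ≤ W.comap (LinearMap.mulLeft ℚ (X i)) := by
    intro i
    refine sup_le (Submodule.span_le.2 ?_) fun p hp => hideal _ (Ideal.mul_mem_left _ _ hp)
    rintro _ ⟨c, rfl⟩
    by_cases hi : i ∈ s c
    · exact hmem c i hi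
    · exact hnotMem c i hi
  rw [eq_top_iff]
  rintro p -
  induction p using MvPolynomial.induction_on with
  | C a =>
    have := hface o
    rw [h.empty, Finset.prod_empty] at this
    rw [← mul_one (C a), ← smul_eq_C_mul]
    exact W.smul_mem a this
  | add p q hp hq => exact W.add_mem hp hq
  | mul_X p i hp => rw [mul_comm]; exact hX i hp

/-- Modulo the ideal a polynomial is a combination of face monomials, and these send the base vector
to nonzero multiples of distinct basis vectors. -/
theorem apply_eq_zero_iff (h : IsFaceAction s o g T) (hφ : ∀ i, φ (X i) = T i)
    {p : MvPolynomial R ℚ} :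
    φ p (Finsupp.single o 1) = 0 ↔ p ∈ nonFaceIdeal s ⊔ quadricIdeal g := by
  refine ⟨fun hp => ?_, h.apply_eq_zero_of_mem hφ⟩
  have hp' : p ∈ (⊤ : Submodule ℚ (MvPolynomial R ℚ)) := trivial
  rw [← h.span_sup_eq_top, Submodule.mem_sup] at hp'
  obtain ⟨y, hy, q, hq, rfl⟩ := hp'
  have hq' : q ∈ nonFaceIdeal s ⊔ quadricIdeal g := hq
  rw [map_add, LinearMap.add_apply, h.apply_eq_zero_of_mem hφ hq', add_zero] at hp
  obtain ⟨f, rfl⟩ := (Finsupp.mem_span_range_iff_exists_finsupp).1 hy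
  choose l hl hl' using fun c => h.prod_apply_face hφ _ c rfl
  have hf : f = 0 := by
    ext c
    have h1 : f.sum (fun c a => Finsupp.single c (a * l c)) = 0 := by
      rw [← hp, Finsupp.sum, Finsupp.sum, map_sum, LinearMap.sum_apply]
      refine Finset.sum_congr rfl fun c _ => ?_
      rw [map_smul, LinearMap.smul_apply, hl', Finsupp.smul_single, Finsupp.smul_single,
        smul_eq_mul, smul_eq_mul, mul_one]
    have h2 := DFunLike.congr_fun h1 c
    rw [Finsupp.sum, Finsupp.finsetSum_apply, Finset.sum_eq_single c] at h2
    · rw [Finsupp.single_eq_same, Finsupp.coe_zero, Pi.zero_apply] at h2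
      exact (mul_eq_zero.1 h2).resolve_right (hl c)
    · intro d _ hd
      exact Finsupp.single_eq_of_ne hd.symm
    · intro hc
      rw [Finsupp.notMem_support_iff.1 hc, zero_mul, Finsupp.single_zero, Finsupp.coe_zero,
        Pi.zero_apply]
  rw [hf, Finsupp.sum_zero_index, zero_add]
  exact hq'

end IsFaceAction

/-- A cyclic module over a polynomial ring carries a product for which the polynomial ring acts by
multiplication. -/
theorem exists_mul_of_surjective {R M : Type*} [AddCommGroup M] [Module ℚ M]
    (φ : MvPolynomial R ℚ →ₐ[ℚ] Module.End ℚ M) (e : M)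
    (hsurj : Function.Surjective fun p => φ p e) :
    ∃ mul : M →ₗ[ℚ] M →ₗ[ℚ] M, (∀ p z, mul (φ p e) z = φ p z) ∧ (∀ a b, mul a b = mul b a) ∧
      (∀ a b c, mul (mul a b) c = mul a (mul b c)) ∧ ∀ a, mul e a = a := by
  let ev : MvPolynomial R ℚ →ₗ[ℚ] M := LinearMap.applyₗ e ∘ₗ φ.toLinearMap
  have hev : ∀ p, ev p = φ p e := fun _ => rfl
  obtain ⟨r, hr⟩ := ev.exists_rightInverse_of_surjective (LinearMap.range_eq_top.2 hsurj)
  have hr' : ∀ a, φ (r a) e = a := fun a => LinearMap.congr_fun hr a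
  have hcomm : ∀ p q z, φ p (φ q z) = φ q (φ p z) := fun p q z => by
    rw [← Module.End.mul_apply, ← Module.End.mul_apply, ← map_mul, ← map_mul, mul_comm]
  -- Independence of the lift: two polynomials that agree on the generator `e` agree everywhere,
  -- since the action commutes and the module is cyclic.
  have key : ∀ p z, φ (r (φ p e)) z = φ p z := fun p z => by
    rw [← hr' z, hcomm, hr', hcomm]
  refine ⟨φ.toLinearMap ∘ₗ r, key, fun a b => ?_, fun a b c => ?_, fun a => ?_⟩
  · change φ (r a) b = φ (r b) a
    conv_lhs => rw [← hr' b]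
    rw [hcomm, hr']
  · change φ (r (φ (r a) b)) c = φ (r a) (φ (r b) c)
    conv_lhs => rw [← hr' b]
    rw [← Module.End.mul_apply, ← map_mul, key, map_mul, Module.End.mul_apply]
  · change φ (r e) a = a
    have := key 1 a
    rwa [map_one, Module.End.one_apply, Module.End.one_apply] at this

end CommutingOperators

/-! ### Ray divisors, their relations, and the resulting ring -/

namespace Fan

variable {N : Type*} [AddCommGroup N] [Module.Finite ℤ N] {F : Fan N}

theorem rays_bot (hF : F.IsSimplicial) : rays (⟨⊥, F.bot_mem⟩ : F.cones) = ∅ := by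
  rw [Finset.eq_empty_iff_forall_notMem]
  intro ρ hρ
  exact gen_ne_zero hF ρ ((gen_mem_iff hF).2 (mem_rays.1 hρ))

theorem rays_ray [DecidableEq F.Ray] (hF : F.IsSimplicial) (ρ : F.Ray) :
    rays ρ.1 = insert ρ (rays (⟨⊥, F.bot_mem⟩ : F.cones)) := by
  rw [rays_bot hF]
  ext ρ'
  rw [mem_rays, Finset.mem_insert, or_iff_left (Finset.notMem_empty _)]
  refine ⟨fun h => ?_, fun h => h ▸ le_rfl⟩
  have h' := (gen_mem_iff hF).2 h
  rw [coe_ray_eq hF ρ, mem_hull_singleton] at h'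
  obtain ⟨c, hc, h'⟩ := h'
  have hc0 : c ≠ 0 := by
    rintro rfl
    exact gen_ne_zero hF ρ' (by rw [h', zero_smul])
  have : (ρ' : Cone N) = ρ := by
    rw [coe_ray_eq hF, coe_ray_eq hF, h', hull_singleton_smul (lt_of_le_of_ne hc hc0.symm)]
  exact Subtype.ext (Subtype.ext this)

theorem nonFaceIdeal_rays [DecidableEq F.Ray] (hF : F.IsSimplicial) :
    nonFaceIdeal (rays (F := F)) = F.stanleyReisner := by
  have : ∀ S : Finset F.Ray, (∃ c, rays c = S) ↔ ∃ σ ∈ F.cones, ∀ ρ ∈ S, (ρ : Cone N) ≤ σ := by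
    intro S
    constructor
    · rintro ⟨c, rfl⟩
      exact ⟨c, c.2, fun ρ hρ => mem_rays.1 hρ⟩
    · rintro ⟨σ, hσ, h⟩
      exact exists_rays_eq hF ⟨σ, hσ⟩ fun ρ hρ => mem_rays.2 (h ρ hρ)
  rw [nonFaceIdeal, stanleyReisner]
  simp only [this]

end Fan

namespace InnerProduct

open Fan

variable {N : Type*} [AddCommGroup N] [Module.Free ℤ N] [Module.Finite ℤ N] {F : Fan N}
  [DecidableEq F.Ray]

theorem coeff_rayDivisor_eq_zero (hF : F.IsSimplicial) (B : InnerProduct (MQ N)) {σ τ : F.cones}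
    {i : F.Ray} (hi : i ∉ rays τ) : (B.complements F).coeff σ τ (rayDivisor hF i) = 0 := by
  by_cases h : IsFacetOf (σ : Cone N) τ
  · obtain ⟨a, ha, hτ⟩ := (isFacetOf_iff hF).1 h
    obtain ⟨c, -, hc⟩ := (isNormalVector_normalVector hF ha hτ).2
    rw [B.coeff_eq hF ha hτ hc (m := 0), LinearMap.zero_apply, mul_zero]
    intro ρ hρ
    rw [coord_rayDivisor, Pi.single_eq_of_ne, LinearMap.zero_apply]
    rintro rfl
    exact hi hρ
  · rw [Complements.coeff_of_not_isFacetOf _ h, LinearMap.zero_apply]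

/-- The local equation of `D_i` on `τ` vanishes on `σ`, so `π_σ` fixes it and the inner product does
not enter. -/
theorem coeff_rayDivisor_self (hF : F.IsSimplicial) (B : InnerProduct (MQ N)) {σ τ : F.cones}
    {i : F.Ray} (hi : i ∉ rays σ) (hτ : rays τ = insert i (rays σ)) {c : ℚ}
    (hc : ι (normalVector (τ : Cone N) σ) - c • gen i ∈ linSpan (σ : Cone N)) :
    (B.complements F).coeff σ τ (rayDivisor hF i) = c := by
  obtain ⟨m, hm⟩ := exists_dual_eq_on (linearIndepOn_gen hF τ) (coord (rayDivisor hF i))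
  rw [B.coeff_eq hF hi hτ hc hm]
  have hmσ : m ∈ perp (σ : Cone N) := (mem_perp_iff hF).2 fun ρ hρ => by
    rw [hm ρ (Finset.mem_coe.2 (hτ ▸ Finset.mem_insert_of_mem hρ)), coord_rayDivisor,
      Pi.single_eq_of_ne]
    rintro rfl
    exact hi hρ
  have h1 := perp_apply hmσ (B.sub_offSpan_mem σ (gen i))
  rw [map_sub, sub_eq_zero] at h1
  rw [← h1, hm i (Finset.mem_coe.2 (hτ ▸ Finset.mem_insert_self _ _)), coord_rayDivisor,
    Pi.single_eq_same, mul_one]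

theorem act_rayDivisor_of_not_face (hF : F.IsSimplicial) (B : InnerProduct (MQ N)) {σ : F.cones}
    {i : F.Ray} (hi : i ∉ rays σ) (h : ¬ ∃ τ : F.cones, rays τ = insert i (rays σ)) :
    (B.complements F).act (rayDivisor hF i) (V σ) = 0 := by
  rw [Complements.act_V]
  refine Finset.sum_eq_zero fun τ _ => ?_
  by_cases hf : IsFacetOf (σ : Cone N) τ
  · obtain ⟨a, ha, hτ⟩ := (isFacetOf_iff hF).1 hf
    rw [B.coeff_rayDivisor_eq_zero hF, zero_smul]
    rw [hτ, Finset.mem_insert, not_or]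
    refine ⟨?_, hi⟩
    rintro rfl
    exact h ⟨τ, hτ⟩
  · rw [Complements.coeff_of_not_isFacetOf _ hf, LinearMap.zero_apply, zero_smul]

theorem act_rayDivisor_of_face (hF : F.IsSimplicial) (B : InnerProduct (MQ N)) {σ τ : F.cones}
    {i : F.Ray} (hi : i ∉ rays σ) (hτ : rays τ = insert i (rays σ)) {c : ℚ}
    (hc : ι (normalVector (τ : Cone N) σ) - c • gen i ∈ linSpan (σ : Cone N)) :
    (B.complements F).act (rayDivisor hF i) (V σ) = c • V τ := by
  rw [Complements.act_V, Finset.sum_eq_single τ]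
  · rw [B.coeff_rayDivisor_self hF hi hτ hc]
  · intro δ _ hδ
    by_cases hf : IsFacetOf (σ : Cone N) δ
    · obtain ⟨a, ha, hδa⟩ := (isFacetOf_iff hF).1 hf
      rw [B.coeff_rayDivisor_eq_zero hF, zero_smul]
      rw [hδa, Finset.mem_insert, not_or]
      refine ⟨?_, hi⟩
      rintro rfl
      exact hδ (rays_injective hF (hδa.trans hτ.symm))
    · rw [Complements.coeff_of_not_isFacetOf _ hf, LinearMap.zero_apply, zero_smul]
  · simp

theorem act_rayDivisor_fundamentalCycle (hF : F.IsSimplicial) (B : InnerProduct (MQ N))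
    (i : F.Ray) : (B.complements F).act (rayDivisor hF i) F.fundamentalCycle = V i.1 := by
  -- The factor is `1` because `gen i` is by definition the normal vector of the ray over the zero
  -- cone.
  rw [fundamentalCycle, B.act_rayDivisor_of_face hF (by rw [rays_bot hF]; exact Finset.notMem_empty i)
    (rays_ray hF i) (c := 1) ?_, one_smul]
  rw [one_smul]
  exact (sub_self (gen i)).symm ▸ zero_mem _

/-- The combination of ray divisors has the global equation `ω (gen i)`. As `gen i` lies in `σ`,
this form is orthogonal to `M(σ)` and its projection is zero. -/
theorem sum_smul_act_rayDivisor (hF : F.IsSimplicial) (B : InnerProduct (MQ N)) {σ : F.cones}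
    {i : F.Ray} (hi : i ∈ rays σ) :
    ∑ j, B.ω (gen j) (gen i) • (B.complements F).act (rayDivisor hF j) (V σ) = 0 := by
  set E : F.QCartier := ∑ j, B.ω (gen j) (gen i) • rayDivisor hF j with hE
  have hcoord : coord E = fun j => B.ω (gen j) (gen i) := by
    rw [hE, map_sum]
    simp only [map_smul, coord_rayDivisor]
    exact (pi_eq_sum_univ' _).symm
  have hsum : ∑ j, B.ω (gen j) (gen i) • (B.complements F).act (rayDivisor hF j) (V σ) =
      (B.complements F).actHom E (V σ) := by
    rw [hE, map_sum, LinearMap.sum_apply]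
    exact Finset.sum_congr rfl fun j _ => by rw [map_smul]; rfl
  rw [hsum, Complements.actHom_apply, Complements.act_V]
  refine Finset.sum_eq_zero fun τ _ => ?_
  by_cases hf : IsFacetOf (σ : Cone N) τ
  · obtain ⟨a, ha, hτ⟩ := (isFacetOf_iff hF).1 hf
    obtain ⟨c, -, hc⟩ := (isNormalVector_normalVector hF ha hτ).2
    rw [B.coeff_eq hF ha hτ hc (m := B.ω (gen i)) fun ρ _ => by rw [hcoord, B.ω_comm], B.ω_comm,
      (mem_perp_iff hF).1 (B.ω_offSpan_mem σ _) i hi, mul_zero, zero_smul]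
  · rw [Complements.coeff_of_not_isFacetOf _ hf, LinearMap.zero_apply, zero_smul]

/-- The Gram matrix of a cone is inverted by orthogonally projecting `ω⁻¹` of a coordinate form onto
the span of the cone: pairings with the generators are unchanged, and the projection is a
combination of them. -/
theorem exists_dual_combination (hF : F.IsSimplicial) (B : InnerProduct (MQ N)) (σ : F.cones)
    (i : F.Ray) : ∃ a : F.Ray → ℚ, (∀ k, k ∉ rays σ → a k = 0) ∧
      ∀ j ∈ rays σ, ∑ k, a k * B.ω (gen j) (gen k) = if j = i then 1 else 0 := by
  obtain ⟨m, hm⟩ := exists_dual_eq_on (linearIndepOn_gen hF σ) (fun j => if j = i then 1 else 0)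
  have hu := B.sub_offSpan_mem σ (B.ω.symm m)
  rw [linSpan_eq hF, Submodule.mem_span_image_finset_iff_exists_fun'] at hu
  obtain ⟨a, ha⟩ := hu
  refine ⟨fun k => if k ∈ rays σ then a k else 0, fun k hk => if_neg hk, fun j hj => ?_⟩
  have h1 : ∑ k, (if k ∈ rays σ then a k else 0) * B.ω (gen j) (gen k) =
      B.ω (gen j) (∑ k ∈ rays σ, a k • gen k) := by
    rw [map_sum]
    simp only [ite_mul, zero_mul, map_smul, smul_eq_mul]
    rw [Finset.sum_ite_mem, Finset.univ_inter]
  rw [h1, ha, B.ω_comm, map_sub, LinearMap.sub_apply,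
    (mem_perp_iff hF).1 (B.ω_offSpan_mem σ _) j hj, LinearEquiv.apply_symm_apply, sub_zero]
  exact hm j hj

theorem isFaceAction (hF : F.IsSimplicial) (B : InnerProduct (MQ N)) :
    IsFaceAction (rays (F := F)) ⟨⊥, F.bot_mem⟩ (fun i j => B.ω (gen j) (gen i))
      fun i => (B.complements F).actHom (rayDivisor hF i) where
  injective := rays_injective hF
  down := fun c _ hS => exists_rays_eq hF c hS
  empty := rays_bot hF
  step := fun c c' i hi hc' => by
    obtain ⟨l, hl, h⟩ := (isNormalVector_normalVector hF hi hc').2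
    exact ⟨l, hl.ne', B.act_rayDivisor_of_face hF hi hc' h⟩
  step_zero := fun c i hi h => B.act_rayDivisor_of_not_face hF hi h
  linear := fun c i hi => B.sum_smul_act_rayDivisor hF hi
  nondegenerate := fun c i _ => B.exists_dual_combination hF c i

end InnerProduct

open MvPolynomial Fan in
/-- The intersection product and the presentation of the resulting ring. -/
theorem existsUnique_isIntersectionProduct_and_ker_α {N : Type*} [AddCommGroup N] [Module.Free ℤ N] [Module.Finite ℤ N]
    {F : Fan N} (hF : F.IsSimplicial) (B : InnerProduct (MQ N)) :
    (∃! mul : F.Cycles →ₗ[ℚ] F.Cycles →ₗ[ℚ] F.Cycles,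
      (B.complements F).IsIntersectionProduct mul) ∧
    ∀ (mul : F.Cycles →ₗ[ℚ] F.Cycles →ₗ[ℚ] F.Cycles)
      (h : (B.complements F).IsIntersectionProduct mul),
      Function.Surjective h.α ∧
        RingHom.ker h.α = F.stanleyReisner ⊔ B.quadraticIdeal F := by
  classical
  obtain ⟨φ, hφ⟩ := exists_algHom_of_commute
    (fun i => (B.complements F).actHom (rayDivisor hF i)) fun i j => B.act_comm hF _ _
  have hact := B.isFaceAction hF
  have hsurj : Function.Surjective fun p => φ p F.fundamentalCycle := hact.apply_surjective hφ
  have hker : ∀ p, φ p F.fundamentalCycle = 0 ↔ p ∈ F.stanleyReisner ⊔ B.quadraticIdeal F := by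
    intro p
    rw [← nonFaceIdeal_rays hF]
    exact hact.apply_eq_zero_iff hφ
  have hX : ∀ i, φ (X i) F.fundamentalCycle = V i.1 := fun i => by
    rw [hφ, Complements.actHom_apply, B.act_rayDivisor_fundamentalCycle hF]
  have hC : ∀ (a : ℚ) z, φ (C a) z = a • z := fun a z => by
    rw [← mul_one (C a), ← smul_eq_C_mul, map_smul, map_one]; rfl
  -- Any intersection product is determined by the action, since ray divisors generate everything
  -- from `[X]`; this yields uniqueness and later identifies `α`.
  have hmul : ∀ (mul : F.Cycles →ₗ[ℚ] F.Cycles →ₗ[ℚ] F.Cycles),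
      (B.complements F).IsIntersectionProduct mul →
        ∀ p z, mul (φ p F.fundamentalCycle) z = φ p z := by
    intro mul h p
    have hV : ∀ i z, mul (V i.1) z = φ (X i) z := fun i z => by
      rw [← divisorCycle_rayDivisor hF, h.divisor, hφ, Complements.actHom_apply]
    induction p using MvPolynomial.induction_on with
    | C a =>
      intro z
      rw [hC, hC, map_smul, LinearMap.smul_apply, h.one]
    | add p q hp hq =>
      intro z
      rw [map_add, LinearMap.add_apply, LinearMap.add_apply, map_add, LinearMap.add_apply, hp, hq]
    | mul_X p i hp =>
      intro z
      rw [map_mul, Module.End.mul_apply, hX, ← hp, h.assoc, hp, hV, Module.End.mul_apply]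
  refine ⟨?_, fun mul h => ?_⟩
  · obtain ⟨mul, h1, h2, h3, h4⟩ := exists_mul_of_surjective φ F.fundamentalCycle hsurj
    refine ⟨mul, ⟨h2, h3, h4, fun D z => ?_⟩, fun mul' h' => ?_⟩
    · have hD : divisorCycle D = ∑ i, coord D i • φ (X i) F.fundamentalCycle :=
        Finset.sum_congr rfl fun i _ => by rw [hX]; rfl
      rw [hD, map_sum, LinearMap.sum_apply]
      conv_rhs => rw [eq_sum_rayDivisor hF D, ← Complements.actHom_apply, map_sum,
        LinearMap.sum_apply]
      refine Finset.sum_congr rfl fun i _ => ?_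
      rw [map_smul, LinearMap.smul_apply, h1, hφ, map_smul, LinearMap.smul_apply]
    · refine LinearMap.ext₂ fun a z => ?_
      obtain ⟨p, rfl⟩ := hsurj a
      exact (hmul mul' h' p z).trans (h1 p z).symm
  -- Under `α` a polynomial becomes its action on `[X]`, so surjectivity and the kernel are read off
  -- from the cyclic module.
  · have hα : ∀ p, h.α p = h.ofCycle (φ p F.fundamentalCycle) := by
      intro p
      induction p using MvPolynomial.induction_on with
      | C a =>
        rw [hC, Complements.IsIntersectionProduct.α, aeval_C, Algebra.algebraMap_eq_smul_one]
        rfl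
      | add p q hp hq =>
        rw [map_add, map_add, LinearMap.add_apply, hp, hq]
        rfl
      | mul_X p i hp =>
        rw [map_mul, map_mul, Module.End.mul_apply, hX, hp, ← hmul mul h p (V i.1),
          Complements.IsIntersectionProduct.α, aeval_X]
        rfl
    refine ⟨fun z => ?_, Ideal.ext fun p => ?_⟩
    · obtain ⟨p, hp⟩ := hsurj z
      exact ⟨p, (hα p).trans hp⟩
    · rw [RingHom.mem_ker, ← hker]
      exact (hα p).congr_left

end ToricCycle

end

/-- For a simplicial fan, with the action of divisors on cycles defined by an inner product on `M`:
each `[V(ρ)]` is the cycle of a unique `ℚ`-Cartier divisor, there is exactly one intersection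
product on `Z_*(X)_ℚ`, and for the resulting ring structure the homomorphism
`α : ℚ[Y_1, …, Y_r] → Z_*(X)_ℚ` is surjective with kernel `I_Σ + J`. -/
theorem theorem9p1 {N : Type*} [AddCommGroup N] [Module.Free ℤ N] [Module.Finite ℤ N]
    (F : ToricCycle.Fan N) (hF : F.IsSimplicial)
    (B : ToricCycle.InnerProduct (ToricCycle.MQ N)) :
    (∀ ρ : F.Ray, ∃! D : F.QCartier, ToricCycle.Fan.divisorCycle D = ToricCycle.Fan.V ρ.1) ∧
    (∃! mul : F.Cycles →ₗ[ℚ] F.Cycles →ₗ[ℚ] F.Cycles,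
      (B.complements F).IsIntersectionProduct mul) ∧
    ∀ (mul : F.Cycles →ₗ[ℚ] F.Cycles →ₗ[ℚ] F.Cycles)
      (h : (B.complements F).IsIntersectionProduct mul),
      Function.Surjective h.α ∧
        RingHom.ker h.α = F.stanleyReisner ⊔ B.quadraticIdeal F :=
  ⟨ToricCycle.Fan.existsUnique_divisorCycle_eq hF,
    ToricCycle.existsUnique_isIntersectionProduct_and_ker_α hF B⟩
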